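/- **Setting.** Let $n,d,m\ge 1$ be integers with $n\ge 3$ and $\frac md<\frac n2$. Put $\Gamma_0=\{\xi\in(\mathbb R^d)^n:\sum_j\xi_j=0\}$ and let $\Gamma\subset\Gamma_0$ be a linear subspace of dimension $m$. For $A\subset[n]$ let $P_A$ be the projection of $\Gamma$ to the variables $\xi_j$, $j\in A$. *Type I:* $\dim P_A(\Gamma)=m$ whenever $\#A=\lceil m/d\rceil$. *Type II* (for $\frac md<\frac n2\le\lceil\frac md\rceil$): the map $(v^{(1)},\dots,v^{(L)})\mapsto\big((P_A(v^{(1)})-P_A(v^{(k)}))_{2\le k\le L},(P_{B^{(k)}}(v^{(k)}))_{1\le k\le L}\big)$ on $\Gamma^L$ has kernel $\{0\}$ for all of the following choices. If $\frac md\le\frac{n-1}2$ (then $n=2n'+2$ is even): $L=2$ and $A,B^{(1)},B^{(2)}\subset[n]$ are disjoint with $\#A=1$, $\#B^{(1)}=\#B^{(2)}=n'$. If $\frac{n-1}2<\frac md$: write $m=ld+r$ with $0\le r\le d-1$; it is required that $l+1-(d-r)\ge0$; write $l+1-(d-r)=ad+b$ with $0\le b\le d-1$; then $L=d$, the sets $A,U_1,\dots,U_{2d-1},W\subset[n]$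 are disjoint with $\#A=d-r$, $\#U_i=a$, $\#W=b$, and $B^{(k)}=U_k\cup\dots\cup U_{k+d-1}\cup W$. *Rectangles.* A cube $Q\subset\mathbb R^d$ has center $\mathfrak c(Q)$ and side length $s(Q)$; $CQ$ is the concentric cube with side length $Cs(Q)$. Dyadic cubes are $2^l([0,1)^d+z)$, shifted dyadic cubes are $2^l([0,1)^d+z+\alpha)$, with $l\in\mathbb Z$, $z\in\mathbb Z^d$, $\alpha\in\{0,\frac13,\frac23\}^d$. A rectangle is $R=I(R)\times\Xi(R)$ with $I(R)$ dyadic, $\Xi(R)$ shifted dyadic and $s(I(R))s(\Xi(R))=1$. A vector rectangle $\mathcal R=(\mathcal R_1,\dots,\mathcal R_n)$ consists of $n$ rectangles with the same physical cube $I(\mathcal R)$; $\Xi(\mathcal R)=\prod_j\Xi(\mathcal R_j)$, and $s(\Xi(\mathcal R))=s(I(\mathcal R))^{-1}$. A family of sets is a grid if any two members that meet are nested; it is $W$-central if moreover $G\subsetneq G'$ implies $WG\subset G'$. A collection of cubes is $L$-sparse if $s(Q)>s(Q')$ implies $s(Q)>Ls(Q')$, and $s(Q)=s(Q')$, $Q\ne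 Q'$ imply $d(Q,Q')>Ls(Q)$. *Collection.* Let $1\ll C_1\ll C_2\ll C_3$ and let $\mathscr R$ be a finite collection of vector rectangles such that for all $\mathcal R\in\mathscr R$: $\Xi(\mathcal R)\cap\Gamma_0\ne\emptyset$; $d(\Xi(\mathcal R),\Gamma)\sim C_1s(\Xi(\mathcal R))$; any $\lceil m/d\rceil$ of the cubes $\Xi(\mathcal R_j)$ determine all of them (within $\mathscr R$); and, for each $j$, $\{\Xi(\mathcal R_j):\mathcal R\in\mathscr R\}$ is a $C_3$-sparse grid. Fix for each $j$ sets $C_2\circ\Xi(\mathcal R_j)$, depending only on $j$ and $\Xi(\mathcal R_j)$, with $C_2\Xi(\mathcal R_j)\subset C_2\circ\Xi(\mathcal R_j)\subset2C_2\Xi(\mathcal R_j)$, that form a $C_3^{1/3}$-central grid for each $j$ (a set is dilated about the center of its bounding box). Fix functions $\varphi_{\mathcal R_j}$ for $\mathcal R\in\mathscr R$, $j\in[n]$ (depending only on $j$ and $\mathcal R_j$), adapted to $\mathcal R_j=I\times\Xi$, i.e. $\varphi_{\mathcal R_j}(x)=|I|^{-1/2}e^{2\pi i\mathfrak c(\Xi)\cdot(x-\mathfrak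 c(I))}\zeta\big(\frac{x-\mathfrak c(I)}{s(I)}\big)$ with $\zeta$ Schwartz, $\widehat\zeta$ supported in $(-\frac12,\frac12)^d$ and $|\partial^\alpha\zeta(x)|\le D(1+|x|)^{-N_1}$ for $|\alpha|\le1$, with $D,N_1$ independent of $\mathcal R_j$; and measurable functions $|f_j|\le1_{E_j}$ with $E_j\subset\mathbb R^d$ bounded. *Orders and trees.* For rectangles, $R\le R'$ means $I(R)\subset I(R')$, $\Xi(R')\subset\Xi(R)$. For $\mathcal R,\mathcal R'\in\mathscr R$, $\mathcal R\lesssim\mathcal R'$ means $I(\mathcal R)\subset I(\mathcal R')$ and $C_2\circ\Xi(\mathcal R'_j)\subset C_2\circ\Xi(\mathcal R_j)$ for all $j$. A $j$-tree is a non-empty $T\subset\mathscr R_j:=\{\mathcal R_j:\mathcal R\in\mathscr R\}$ for which there are a dyadic cube $I$ and a point $\xi$ with $I(R)\subset I$ and $\xi\in C_2\circ\Xi(R)$ for all $R\in T$; it is lacunary if there is one $\xi$ with $\xi\in C_2\circ\Xi(R)\setminus10\,\Xi(R)$ for all $R\in T$. $I_T$ is the smallest dyadic cube containing all $I(R)$,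 $R\in T$ (also for vector trees), and the counting function of a family $\mathbf F$ of trees is $N_{\mathbf F}=\sum_{T\in\mathbf F}1_{I_T}$. For $\mathscr P\subset\mathscr R_j$, $\mathbf M_j(\mathscr P)$ is the supremum of $\big(|I_T|^{-1}\sum_{R\in T}|\langle f_j|\varphi_R\rangle|^2\big)^{1/2}$ over lacunary $j$-trees $T\subset\mathscr P$ ($0$ if there is none). *Selected trees.* For each $j$ let $\mathscr R_j$ be the disjoint union of $j$-trees, grouped into families $\mathbf F_j(t)$, $t$ dyadic ($t\in 2^{\mathbb Z}$), such that $\mathscr R_j(t):=\bigcup_{T\in\mathbf F_j(t)}T$ satisfies $\mathbf M_j(\mathscr R_j(t))\le t$. For a vector $\lambda$ of dyadic numbers put $\mathscr R(\lambda)=\{\mathcal R\in\mathscr R:\mathcal R_j\in\mathscr R_j(\lambda_j)\ \forall j\}$. The family $\mathbf F(\lambda)$ of vector trees is built greedily: go through the $\lesssim$-maximal elements $\mathcal P$ of $\mathscr R(\lambda)$ in an order of non-decreasing $s(\Xi(\mathcal P))$ (ties broken arbitrarily), each time put into $\mathbf F(\lambda)$ the tree of all $\mathcal R\lesssim\mathcal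 P$ in what is left of $\mathscr R(\lambda)$, and remove it. $\mathbf F^{\ge2}(\lambda)$ and $\mathbf F^{=1}(\lambda)$ consist of the trees in $\mathbf F(\lambda)$ with at least two elements, resp. exactly one. For a vector $\kappa$ of dyadic numbers with $\kappa_j\le\lambda_j$ let $\mathscr R_j(\lambda_j,\kappa_j)=\{R\in\mathscr R_j(\lambda_j):\frac{\kappa_j}2<|I(R)|^{-1/2}|\langle f_j|\varphi_R\rangle|\le\kappa_j\}$, let $\mathscr F_j(\lambda_j,\kappa_j)$ be the family of one-element trees $\{R\}$ with $R$ a $\le$-maximal element of $\mathscr R_j(\lambda_j,\kappa_j)$, and let $\mathbf F^{=1}(\lambda,\kappa)$ be the family of the $\{\mathcal R\}\in\mathbf F^{=1}(\lambda)$ with $\mathcal R_j\in\mathscr R_j(\lambda_j,\kappa_j)$ for all $j$. **Statement.** There is a constant $K>0$ depending only on $n,d,m$ such that, if $C_1$ is large enough (depending on $n,d,m,\Gamma$ and the constant in $\sim$), $C_2$ is large enough (depending also on $C_1$) and $C_3$ is large enough (depending also on $C_2$), the following holds for all choices above, all $\lambda,\kappa$ and all $x\in\mathbb R^d$. Let $(N,N_j)$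 be $(N_{\mathbf F^{\ge2}(\lambda)},N_{\mathbf F_j(\lambda_j)})$ or $(N_{\mathbf F^{=1}(\lambda,\kappa)},N_{\mathscr F_j(\lambda_j,\kappa_j)})$. (i) If $\lceil\frac md\rceil<\frac n2$ and $\Gamma$ is of Type I, then $N(x)\le K\prod_{j\in\Upsilon}N_j(x)$ for all $\Upsilon\subset[n]$ with $\#\Upsilon=\lceil\frac md\rceil$. (ii) If $\frac n2\le\lceil\frac md\rceil$, $\frac md\le\frac{n-1}2$ and $\Gamma$ is of Type I and Type II, then $N(x)\le K\prod_{j\in\Upsilon}N_j(x)^{1/2}$ for all $\Upsilon\subset[n]$ with $\#\Upsilon=n-1$. (iii) If $\frac n2\le\lceil\frac md\rceil$, $\frac{n-1}2<\frac md$ and $\Gamma$ is of Type I and Type II, then $N(x)\le K\prod_{j\in\Upsilon}N_j(x)^{\frac m{d(n-1)}}$ for all $\Upsilon\subset[n]$ with $\#\Upsilon=n-1$. -/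

import Mathlib

open MeasureTheory FourierTransform
open scoped ComplexConjugate

noncomputable section

namespace FractionalRank

/-- Physical space and the space of one frequency variable: `ℝ^d` with its Euclidean norm. -/
abbrev Space (d : ℕ) := EuclideanSpace ℝ (Fin d)

/-- The space `(ℝ^d)^n` of all frequency variables `ξ = (ξ_1, …, ξ_n)`, with its Euclidean norm. -/
abbrev FreqSpace (n d : ℕ) := PiLp 2 (fun _ : Fin n => Space d)

/-- `Γ₀ = {ξ : ξ_1 + ⋯ + ξ_n = 0}`. -/
def gammaZero (n d : ℕ) : Submodule ℝ (FreqSpace n d) where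
  carrier := {ξ | ∑ j, ξ j = 0}
  add_mem' := by
    intro a b ha hb
    simp only [Set.mem_ofPred_eq, PiLp.add_apply, Finset.sum_add_distrib] at *
    rw [ha, hb, add_zero]
  zero_mem' := by simp
  smul_mem' := by
    intro c a ha
    simp only [Set.mem_ofPred_eq, PiLp.smul_apply, ← Finset.smul_sum] at *
    rw [ha, smul_zero]

/-! ### Non-degeneracy of the singular subspace -/

/-- The projection of `(ℝ^d)^n` to the coordinates in `A × [d]`. -/
def proj {n d : ℕ} (A : Finset (Fin n)) : FreqSpace n d →ₗ[ℝ] (A → Space d) where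
  toFun v := fun j => v j
  map_add' _ _ := rfl
  map_smul' _ _ := rfl

/-- Type I non-degeneracy of an `m`-dimensional `Γ`: `dim P_A(Γ) = m` if `#A = ⌈m/d⌉`. -/
def TypeI {n d : ℕ} (m : ℕ) (Γ : Submodule ℝ (FreqSpace n d)) : Prop :=
  ∀ A : Finset (Fin n), A.card = ⌈(m : ℝ) / d⌉₊ →
    Module.finrank ℝ (Γ.map (proj A)) = m

/-- The linear map on `Γ^L` sending `(v^(1), …, v^(L))` to the differences of the `P_A(v^(k))`
and to the `P_{B^(k)}(v^(k))`. All differences `P_A(v^(k)) - P_A(v^(k'))` are listed, instead of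
those with `k = 1` only; this does not change the kernel. -/
def crucialMap {n d : ℕ} (Γ : Submodule ℝ (FreqSpace n d)) (L : ℕ) (A : Finset (Fin n))
    (B : Fin L → Finset (Fin n)) :
    (Fin L → Γ) →ₗ[ℝ] (Fin L → Fin L → A → Space d) × ((k : Fin L) → B k → Space d) where
  toFun v := (fun k k' => proj A (v k : FreqSpace n d) - proj A (v k' : FreqSpace n d),
    fun k => proj (B k) (v k : FreqSpace n d))
  map_add' v w := by
    ext <;> simp [add_sub_add_comm]
  map_smul' c v := by
    ext <;> simp [mul_sub]

/-- Type II non-degeneracy in the medium rank case `m/d ≤ (n-1)/2`, where `n = 2n' + 2`, `L = 2`. -/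
def TypeIIMedium {n d : ℕ} (Γ : Submodule ℝ (FreqSpace n d)) : Prop :=
  ∀ n' : ℕ, n = 2 * n' + 2 → ∀ A B₁ B₂ : Finset (Fin n),
    Disjoint A B₁ → Disjoint A B₂ → Disjoint B₁ B₂ →
    A.card = 1 → B₁.card = n' → B₂.card = n' →
    LinearMap.ker (crucialMap Γ 2 A ![B₁, B₂]) = ⊥

/-- Type II non-degeneracy in the large rank case `(n-1)/2 < m/d`, where `L = d`,
`m = l d + r` with `0 ≤ r ≤ d - 1` and `l + 1 - (d - r) = a d + b` with `0 ≤ b ≤ d - 1`.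
The sets `U_1, …, U_{2d-1}` are indexed from `0`, so that `B^(k) = U_k ∪ ⋯ ∪ U_{k+d-1} ∪ W`
for `0 ≤ k < d`. -/
def TypeIILarge {n d : ℕ} (m : ℕ) (Γ : Submodule ℝ (FreqSpace n d)) : Prop :=
  d - m % d ≤ m / d + 1 ∧
  ∀ a b : ℕ, m / d + 1 - (d - m % d) = a * d + b → b < d →
    ∀ (A W : Finset (Fin n)) (U : Fin (2 * d - 1) → Finset (Fin n)),
      Disjoint A W → (∀ i, Disjoint A (U i)) → (∀ i, Disjoint W (U i)) →
      (∀ i i', i ≠ i' → Disjoint (U i) (U i')) →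
      A.card = d - m % d → W.card = b → (∀ i, (U i).card = a) →
      LinearMap.ker (crucialMap Γ d A (fun k : Fin d =>
        (Finset.univ.filter
          (fun i : Fin (2 * d - 1) => (k : ℕ) ≤ i ∧ (i : ℕ) < k + d)).biUnion U ∪ W)) = ⊥

/-- Type II non-degeneracy. -/
def TypeII {n d : ℕ} (m : ℕ) (Γ : Submodule ℝ (FreqSpace n d)) : Prop :=
  ((m : ℝ) / d ≤ ((n : ℝ) - 1) / 2 → TypeIIMedium Γ) ∧
  (((n : ℝ) - 1) / 2 < (m : ℝ) / d → TypeIILarge m Γ)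

/-! ### Cubes, rectangles, grids -/

/-- A cube in `ℝ^d`, given by its center and its side length. -/
@[ext]
structure Cube (d : ℕ) where
  center : Space d
  side : ℝ

namespace Cube

variable {d : ℕ}

/-- The half-open cube as a set of points. -/
def toSet (Q : Cube d) : Set (Space d) :=
  {x | ∀ k, Q.center k - Q.side / 2 ≤ x k ∧ x k < Q.center k + Q.side / 2}

/-- `C Q`: same center, side length multiplied by `C`. -/
def dilate (C : ℝ) (Q : Cube d) : Cube d := ⟨Q.center, C * Q.side⟩

/-- Dyadic cubes `2^l ([0,1)^d + z)`. -/
def IsDyadic (Q : Cube d) : Prop :=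
  ∃ (l : ℤ) (z : Fin d → ℤ), Q.side = (2 : ℝ) ^ l ∧
    ∀ k, Q.center k = (2 : ℝ) ^ l * ((z k : ℝ) + 1 / 2)

/-- Shifted dyadic cubes `2^l ([0,1)^d + z + α)` with `α ∈ {0, 1/3, 2/3}^d`. -/
def IsShiftedDyadic (Q : Cube d) : Prop :=
  ∃ (l : ℤ) (z : Fin d → ℤ) (α : Fin d → Fin 3), Q.side = (2 : ℝ) ^ l ∧
    ∀ k, Q.center k = (2 : ℝ) ^ l * ((z k : ℝ) + ((α k : ℕ) : ℝ) / 3 + 1 / 2)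

end Cube

/-- A rectangle `I × Ξ` in the phase space. -/
@[ext]
structure Rectangle (d : ℕ) where
  I : Cube d
  Ξ : Cube d
  dyadic : I.IsDyadic
  shifted : Ξ.IsShiftedDyadic
  side_mul : I.side * Ξ.side = 1

/-- A vector rectangle `(R_1, …, R_n)`: `n` rectangles with a common physical cube. -/
@[ext]
structure VectorRectangle (n d : ℕ) where
  I : Cube d
  Ξ : Fin n → Cube d
  dyadic : I.IsDyadic
  shifted : ∀ j, (Ξ j).IsShiftedDyadic
  side_mul : ∀ j, I.side * (Ξ j).side = 1

namespace VectorRectangle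

variable {n d : ℕ}

/-- The `j`-th rectangle `R_j` of a vector rectangle. -/
def comp (R : VectorRectangle n d) (j : Fin n) : Rectangle d :=
  ⟨R.I, R.Ξ j, R.dyadic, R.shifted j, R.side_mul j⟩

/-- `Ξ(R) = Ξ(R_1) × ⋯ × Ξ(R_n)` as a set. -/
def freqSet (R : VectorRectangle n d) : Set (FreqSpace n d) :=
  {ξ | ∀ j, ξ j ∈ (R.Ξ j).toSet}

/-- The scale `s(Ξ(R))`, the common side length of the `Ξ(R_j)`. -/
def freqScale (R : VectorRectangle n d) : ℝ := R.I.side⁻¹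

end VectorRectangle

/-- The distance of two sets. -/
def setDist {X : Type*} [PseudoMetricSpace X] (S T : Set X) : ℝ :=
  sInf (Set.image2 dist S T)

/-- A grid: two members that meet are nested. -/
def IsGrid {d : ℕ} (𝒢 : Set (Set (Space d))) : Prop :=
  ∀ G ∈ 𝒢, ∀ G' ∈ 𝒢, (G ∩ G').Nonempty → G ⊆ G' ∨ G' ⊆ G

/-- The center of the bounding box of a set (the center, for a cube or a box). -/
def boxCenter {d : ℕ} (S : Set (Space d)) : Space d :=
  WithLp.toLp 2 fun k => (sInf ((fun x : Space d => x k) '' S) +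
    sSup ((fun x : Space d => x k) '' S)) / 2

/-- `W S`: the set `S` dilated by the factor `W` about its center. -/
def dilateSet {d : ℕ} (W : ℝ) (S : Set (Space d)) : Set (Space d) :=
  AffineMap.homothety (boxCenter S) W '' S

/-- A `W`-central grid. -/
def IsCentralGrid {d : ℕ} (W : ℝ) (𝒢 : Set (Set (Space d))) : Prop :=
  IsGrid 𝒢 ∧ ∀ G ∈ 𝒢, ∀ G' ∈ 𝒢, G ⊂ G' → dilateSet W G ⊆ G'

/-- An `L`-sparse collection of cubes. -/
def IsSparse {d : ℕ} (L : ℝ) (𝒬 : Set (Cube d)) : Prop :=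
  (∀ Q ∈ 𝒬, ∀ Q' ∈ 𝒬, Q'.side < Q.side → L * Q'.side < Q.side) ∧
  (∀ Q ∈ 𝒬, ∀ Q' ∈ 𝒬, Q.side = Q'.side → Q ≠ Q' → L * Q.side < setDist Q.toSet Q'.toSet)

/-! ### The collection of vector rectangles -/

section Collection

variable {n d : ℕ}

/-- `𝓡_j = {R_j : R ∈ 𝓡}`. -/
def scalarRects (𝓡 : Set (VectorRectangle n d)) (j : Fin n) : Set (Rectangle d) :=
  (fun R => R.comp j) '' 𝓡

/-- `{Ξ(R_j) : R ∈ 𝓡}`. -/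
def freqCubes (𝓡 : Set (VectorRectangle n d)) (j : Fin n) : Set (Cube d) :=
  (fun R => R.Ξ j) '' 𝓡

/-- The finite collections `𝓡` of vector rectangles of the discrete model: they meet `Γ₀` in
frequency, have the Whitney property with respect to `Γ` (where `∼` is up to the factor `c₀`),
any `⌈m/d⌉` of the frequency cubes determine all of them, and the frequency cubes in each
component form a `C₃`-sparse grid. -/
structure IsModelCollection (m : ℕ) (Γ : Submodule ℝ (FreqSpace n d)) (c₀ C₁ C₃ : ℝ)
    (𝓡 : Set (VectorRectangle n d)) : Prop where
  finite : 𝓡.Finite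
  meets : ∀ R ∈ 𝓡, (R.freqSet ∩ (gammaZero n d : Set (FreqSpace n d))).Nonempty
  whitney : ∀ R ∈ 𝓡,
    c₀⁻¹ * (C₁ * R.freqScale) ≤ setDist R.freqSet (Γ : Set (FreqSpace n d)) ∧
    setDist R.freqSet (Γ : Set (FreqSpace n d)) ≤ c₀ * (C₁ * R.freqScale)
  determined : ∀ A : Finset (Fin n), A.card = ⌈(m : ℝ) / d⌉₊ → ∀ R ∈ 𝓡, ∀ R' ∈ 𝓡,
    (∀ j ∈ A, R.Ξ j = R'.Ξ j) → R.Ξ = R'.Ξ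
  grid : ∀ j, IsGrid (Cube.toSet '' freqCubes 𝓡 j)
  sparse : ∀ j, IsSparse C₃ (freqCubes 𝓡 j)

/-- `G j Ξ` is an admissible choice of the enlarged frequency cubes `C₂ ∘ Ξ`, `Ξ = Ξ(R_j)`:
`C₂ Ξ ⊆ C₂ ∘ Ξ ⊆ 2 C₂ Ξ`, and for each `j` they form a `C₃^{1/3}`-central grid. -/
def IsCentralization (C₂ C₃ : ℝ) (𝓡 : Set (VectorRectangle n d))
    (G : Fin n → Cube d → Set (Space d)) : Prop :=
  ∀ j, (∀ Q ∈ freqCubes 𝓡 j,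
      (Q.dilate C₂).toSet ⊆ G j Q ∧ G j Q ⊆ (Q.dilate (2 * C₂)).toSet) ∧
    IsCentralGrid (C₃ ^ (1 / 3 : ℝ)) (G j '' freqCubes 𝓡 j)

/-- `φ` is a wave packet adapted to `R`, with decay exponent `N₁` and constant `D`. -/
def IsWavePacket (N₁ : ℕ) (D : ℝ) (R : Rectangle d) (φ : Space d → ℂ) : Prop :=
  ∃ ζ : SchwartzMap (Space d) ℂ,
    (∀ ξ, 𝓕 (ζ : Space d → ℂ) ξ ≠ 0 → ∀ k, -(1 / 2) < ξ k ∧ ξ k < 1 / 2) ∧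
    (∀ x, ‖ζ x‖ ≤ D * ((1 + ‖x‖) ^ N₁)⁻¹) ∧
    (∀ x k, ‖fderiv ℝ ζ x (EuclideanSpace.single k 1)‖ ≤ D * ((1 + ‖x‖) ^ N₁)⁻¹) ∧
    ∀ x, φ x = (((volume.real R.I.toSet) ^ (-(1 / 2) : ℝ) : ℝ) : ℂ) *
      Complex.exp (2 * Real.pi * Complex.I * (inner ℝ R.Ξ.center (x - R.I.center) : ℝ)) *
      ζ (R.I.side⁻¹ • (x - R.I.center))

/-- `⟨f | g⟩`. -/
def pairing (f g : Space d → ℂ) : ℂ := ∫ x, f x * conj (g x)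

end Collection

/-! ### Order relations, trees, mass, counting functions -/

section Trees

variable {n d : ℕ}

/-- `R ≤ R'` for rectangles. -/
def Rectangle.Le (R R' : Rectangle d) : Prop :=
  R.I.toSet ⊆ R'.I.toSet ∧ R'.Ξ.toSet ⊆ R.Ξ.toSet

/-- `R ≲ R'` for rectangles, where `G Ξ` stands for `C₂ ∘ Ξ`. -/
def Rectangle.Lesssim (G : Cube d → Set (Space d)) (R R' : Rectangle d) : Prop :=
  R.I.toSet ⊆ R'.I.toSet ∧ G R'.Ξ ⊆ G R.Ξ

/-- `R ≲ R'` for vector rectangles. -/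
def VectorRectangle.Lesssim (G : Fin n → Cube d → Set (Space d))
    (R R' : VectorRectangle n d) : Prop :=
  ∀ j, Rectangle.Lesssim (G j) (R.comp j) (R'.comp j)

/-- The smallest dyadic cube that contains all cubes of the collection `𝓘`, as a set. (Dyadic
cubes with this property are nested when `𝓘` is non-empty, so that the smallest one is the
intersection of all of them.) -/
def topCube (𝓘 : Set (Cube d)) : Set (Space d) :=
  ⋂ J ∈ {J : Cube d | J.IsDyadic ∧ ∀ I ∈ 𝓘, I.toSet ⊆ J.toSet}, J.toSet

/-- `I_T` for a `j`-tree `T`. -/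
def scalarTop (T : Set (Rectangle d)) : Set (Space d) := topCube (Rectangle.I '' T)

/-- `I_T` for a vector tree `T`. -/
def vectorTop (T : Set (VectorRectangle n d)) : Set (Space d) :=
  topCube (VectorRectangle.I '' T)

/-- The counting function `N_F = ∑_{T ∈ F} 1_{I_T}` of a (finite) family of `j`-trees. -/
def scalarCount (F : Set (Set (Rectangle d))) (x : Space d) : ℝ :=
  ({T ∈ F | x ∈ scalarTop T}.ncard : ℝ)

/-- The counting function `N_F = ∑_{T ∈ F} 1_{I_T}` of a (finite) family of vector trees. -/
def vectorCount (F : Set (Set (VectorRectangle n d))) (x : Space d) : ℝ :=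
  ({T ∈ F | x ∈ vectorTop T}.ncard : ℝ)

/-- A non-empty collection `T` of rectangles is a tree: all `R ∈ T` satisfy `R ≲ (I, ξ)` for
some dyadic cube `I` and some point `ξ`. -/
def IsTree (G : Cube d → Set (Space d)) (T : Set (Rectangle d)) : Prop :=
  T.Nonempty ∧ ∃ (I : Cube d) (ξ : Space d), I.IsDyadic ∧
    ∀ R ∈ T, R.I.toSet ⊆ I.toSet ∧ ξ ∈ G R.Ξ

/-- Lacunary trees. -/
def IsLacunaryTree (G : Cube d → Set (Space d)) (T : Set (Rectangle d)) : Prop :=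
  IsTree G T ∧ ∃ ξ : Space d, ∀ R ∈ T, ξ ∈ G R.Ξ \ (R.Ξ.dilate 10).toSet

/-- The mass `M_j(P)` of a finite collection `P` of rectangles. -/
def mass (G : Cube d → Set (Space d)) (f : Space d → ℂ) (φ : Rectangle d → Space d → ℂ)
    (P : Set (Rectangle d)) : ℝ :=
  sSup {a | ∃ T ⊆ P, IsLacunaryTree G T ∧
    a = √((volume.real (scalarTop T))⁻¹ * ∑ᶠ R ∈ T, ‖pairing f (φ R)‖ ^ 2)}

/-- Dyadic numbers `2^l`. -/
def IsDyadicNumber (t : ℝ) : Prop := ∃ l : ℤ, t = (2 : ℝ) ^ l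

/-- `F t`, for dyadic `t`, are the families of trees of a mass decomposition of the collection
`P` of rectangles: the trees are pairwise disjoint, their union is `P`, and the mass of
`P(t) = ⋃ F t` is at most `t`. -/
structure IsTreeSelection (G : Cube d → Set (Space d)) (f : Space d → ℂ)
    (φ : Rectangle d → Space d → ℂ) (P : Set (Rectangle d))
    (F : ℝ → Set (Set (Rectangle d))) : Prop where
  tree : ∀ t, IsDyadicNumber t → ∀ T ∈ F t, IsTree G T
  disjoint_level : ∀ t, IsDyadicNumber t → ∀ T ∈ F t, ∀ T' ∈ F t, T ≠ T' → Disjoint T T'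
  disjoint : ∀ t t', IsDyadicNumber t → IsDyadicNumber t' → t ≠ t' →
    Disjoint (⋃₀ F t) (⋃₀ F t')
  union : ⋃ t ∈ {t | IsDyadicNumber t}, ⋃₀ F t = P
  mass_le : ∀ t, IsDyadicNumber t → mass G f φ (⋃₀ F t) ≤ t

/-! ### Reorganization into vector trees -/

/-- `𝓡(λ) = {R ∈ 𝓡 : R_j ∈ 𝓡_j(λ_j) for all j}` with `𝓡_j(λ_j) = ⋃ F_j(λ_j)`. -/
def level (𝓡 : Set (VectorRectangle n d)) (F : Fin n → ℝ → Set (Set (Rectangle d)))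
    (lam : Fin n → ℝ) : Set (VectorRectangle n d) :=
  {R ∈ 𝓡 | ∀ j, R.comp j ∈ ⋃₀ F j (lam j)}

/-- The elements of `S` that are maximal with respect to `≲`. -/
def maximalRects (G : Fin n → Cube d → Set (Space d)) (S : Set (VectorRectangle n d)) :
    Set (VectorRectangle n d) :=
  {P ∈ S | ∀ R ∈ S, P.Lesssim G R → R = P}

/-- `e 0, e 1, …` lists the maximal elements of `S` in an order in which the greedy algorithm may
choose them: each time one of smallest frequency scale among those that are left. -/
structure IsSelectionOrder (G : Fin n → Cube d → Set (Space d))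
    (S : Set (VectorRectangle n d)) {N : ℕ} (e : Fin N → VectorRectangle n d) : Prop where
  injective : Function.Injective e
  range_eq : Set.range e = maximalRects G S
  smallest : ∀ i i', i ≤ i' → (e i).freqScale ≤ (e i').freqScale

/-- The vector tree taken out in step `i`: all `R ≲ e i` in what is left of `S`. -/
def selectedTree (G : Fin n → Cube d → Set (Space d)) (S : Set (VectorRectangle n d)) {N : ℕ}
    (e : Fin N → VectorRectangle n d) (i : Fin N) : Set (VectorRectangle n d) :=
  {R ∈ S | R.Lesssim G (e i) ∧ ∀ i' < i, ¬ R.Lesssim G (e i')}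

/-- The family `F(λ)` of all selected vector trees, for `S = 𝓡(λ)`. -/
def selectedTrees (G : Fin n → Cube d → Set (Space d)) (S : Set (VectorRectangle n d)) {N : ℕ}
    (e : Fin N → VectorRectangle n d) : Set (Set (VectorRectangle n d)) :=
  Set.range (selectedTree G S e)

/-- `F^{≥2}`: the trees with at least two elements. -/
def largeTrees (F : Set (Set (VectorRectangle n d))) : Set (Set (VectorRectangle n d)) :=
  {T ∈ F | 2 ≤ T.ncard}

/-- `F^{=1}`: the trees with exactly one element. -/
def singleTrees (F : Set (Set (VectorRectangle n d))) : Set (Set (VectorRectangle n d)) :=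
  {T ∈ F | T.ncard = 1}

/-- `𝓡_j(λ_j, κ_j)`: the `R` in `P = 𝓡_j(λ_j)` with `κ_j/2 < |⟨f_j|φ_R⟩| / |I(R)|^{1/2} ≤ κ_j`. -/
def sizeLevel (f : Space d → ℂ) (φ : Rectangle d → Space d → ℂ) (P : Set (Rectangle d))
    (kap : ℝ) : Set (Rectangle d) :=
  {R ∈ P | kap / 2 < ‖pairing f (φ R)‖ / √(volume.real R.I.toSet) ∧
    ‖pairing f (φ R)‖ / √(volume.real R.I.toSet) ≤ kap}

/-- The family of one-element trees `{R}`, with `R` running through the elements of `P` that are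
maximal with respect to `≤`. -/
def maximalSingletons (P : Set (Rectangle d)) : Set (Set (Rectangle d)) :=
  (fun R => {R}) '' {R ∈ P | ∀ R' ∈ P, R.Le R' → R' = R}

/-- `F^{=1}(λ, κ)`: the one-element trees in `F` whose element `R` satisfies
`R_j ∈ Q j` for all `j`, where `Q j = 𝓡_j(λ_j, κ_j)`. -/
def singleTreesAt (F : Set (Set (VectorRectangle n d))) (Q : Fin n → Set (Rectangle d)) :
    Set (Set (VectorRectangle n d)) :=
  {T ∈ singleTrees F | ∀ R ∈ T, ∀ j, R.comp j ∈ Q j}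

/-- The pointwise bounds of a counting function `M` by the counting functions `N_j`, in the
three cases for `(n, d, m, Γ)`, with the implicit constant `K`. -/
def CountingBounds (m : ℕ) (Γ : Submodule ℝ (FreqSpace n d)) (K : ℝ)
    (M : Space d → ℝ) (N : Fin n → Space d → ℝ) : Prop :=
  ((⌈(m : ℝ) / d⌉₊ : ℝ) < (n : ℝ) / 2 → TypeI m Γ →
    ∀ Υ : Finset (Fin n), Υ.card = ⌈(m : ℝ) / d⌉₊ →
      ∀ x, M x ≤ K * ∏ j ∈ Υ, N j x) ∧
  ((n : ℝ) / 2 ≤ (⌈(m : ℝ) / d⌉₊ : ℝ) → (m : ℝ) / d ≤ ((n : ℝ) - 1) / 2 →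
    TypeI m Γ → TypeII m Γ →
    ∀ Υ : Finset (Fin n), Υ.card = n - 1 →
      ∀ x, M x ≤ K * ∏ j ∈ Υ, N j x ^ (1 / 2 : ℝ)) ∧
  ((n : ℝ) / 2 ≤ (⌈(m : ℝ) / d⌉₊ : ℝ) → ((n : ℝ) - 1) / 2 < (m : ℝ) / d →
    TypeI m Γ → TypeII m Γ →
    ∀ Υ : Finset (Fin n), Υ.card = n - 1 →
      ∀ x, M x ≤ K * ∏ j ∈ Υ, N j x ^ ((m : ℝ) / ((d : ℝ) * ((n : ℝ) - 1))))

end Trees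

end FractionalRank

end

open FractionalRank

/-!
The proof gives the constant `K = 1`.

Fix a point `x`. A selected tree whose top cube contains `x` is represented by its top
rectangle `P`, and `P` by a point `γ ∈ Γ` close to `Ξ(P)` and the scale `s = s(Ξ(P))`. In each
variable `j` it receives a colour: for trees with at least two elements, the selected `j`-tree
that contains `P_j`; for one-element trees, a `≤`-maximal rectangle above `P_j`. There are
`N_j(x)` colours available. Two facts connect the colours with the geometry
(`IsSeparatedColouring`). Points with the same `j`-colour have `j`-th components at distance at
most `ρ` times the larger scale, because the frequencies share an anchor. On the other hand
distinct points cannot be close in all variables, not even up to a prescribed larger multiple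
`σ` of the larger scale. For one-element trees the tops would be comparable otherwise
(`eq_of_close_of_maximal`). For larger trees the greedy selection would have put a second element
of one tree into the other one (`eq_of_close_of_two_le_ncard`).

The rest is combinatorics. Let `A` and `B^(1), …, B^(L)` be sets of variables for which
`crucialMap` is injective, with `#(A ∪ B^(k)) = ⌈m/d⌉`. An `L`-tuple of points with common
`A`-colours is determined by the `B^(k)`-colours of its `k`-th members
(`IsSeparatedColouring.tuple_eq`): injectivity gives equality at the index of the largest scale,
thus equality of the `A`-colours, and Type I non-degeneracy gives equality at the other indices.
By the power mean inequality there are at least `|X|^L / (∏_{j ∈ A} N_j)^(L-1)` such tuples, so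
`|X|^L ≤ (∏_{j ∈ A} N_j)^(L-1) ∏_k ∏_{j ∈ B^(k)} N_j`. The three cases of the theorem are
`L = 1`, `A = ∅`; `L = 2`, where the right-hand side is the product over `Υ`; and `L = d`, where
the exponents on the right-hand side add up to `m` and become equal by averaging over the cyclic
rearrangements of `Υ`.
-/

namespace FractionalRank

/-! ### Counting coloured tuples -/

section Counting

variable {α ι β : Type*}

/-- Count the `L`-tuples from `X` whose members share their `A`-colours: there are at least
`|X|^L / (∏_{j ∈ A} |Col j|)^(L-1)` of them by the power mean inequality, and at most
`∏_k ∏_{j ∈ B k} |Col j|` if the `B k`-colours of the `k`-th members determine such a tuple. -/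
lemma card_pow_le_of_determined [DecidableEq β] (X : Finset α)
    (col : ι → α → β) (Col : ι → Finset β) (hcol : ∀ p ∈ X, ∀ j, col j p ∈ Col j)
    (A : Finset ι) (k : ℕ) (B : Fin (k + 1) → Finset ι)
    (hdet : ∀ P P' : Fin (k + 1) → α, (∀ i, P i ∈ X) → (∀ i, P' i ∈ X) →
      (∀ i i', ∀ j ∈ A, col j (P i) = col j (P i')) →
      (∀ i i', ∀ j ∈ A, col j (P' i) = col j (P' i')) →
      (∀ i, ∀ j ∈ B i, col j (P i) = col j (P' i)) → P = P') :
    X.card ^ (k + 1) ≤ (∏ j ∈ A, (Col j).card) ^ k * ∏ i, ∏ j ∈ B i, (Col j).card := by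
  classical
  set Y : Finset (A → β) := Fintype.piFinset fun j : A => Col j with hY
  have hYcard : Y.card = ∏ j ∈ A, (Col j).card := by
    rw [hY, Fintype.card_piFinset]
    exact Finset.prod_coe_sort A fun j => (Col j).card
  let c : α → A → β := fun p j => col j p
  have hmaps : ∀ p ∈ X, c p ∈ Y := fun p hp => by
    simp only [hY, Fintype.mem_piFinset]; exact fun j => hcol p hp j
  have hsum : X.card = ∑ y ∈ Y, (X.filter fun p => c p = y).card :=
    Finset.card_eq_sum_card_fiberwise hmaps
  set Z : Finset (Σ _ : A → β, Fin (k + 1) → α) :=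
    Y.sigma fun y => Fintype.piFinset fun _ : Fin (k + 1) => X.filter fun p => c p = y with hZ
  have hZcard : Z.card = ∑ y ∈ Y, (X.filter fun p => c p = y).card ^ (k + 1) := by
    simp [hZ, Finset.card_sigma, Fintype.card_piFinset]
  have hZle : Z.card ≤ ∏ i, ∏ j ∈ B i, (Col j).card := by
    let W : Finset ((i : Fin (k + 1)) → B i → β) :=
      Fintype.piFinset fun i => Fintype.piFinset fun j : B i => Col j
    have hW : W.card = ∏ i, ∏ j ∈ B i, (Col j).card := by
      simp only [W, Fintype.card_piFinset]
      exact Finset.prod_congr rfl fun i _ => Finset.prod_coe_sort (B i) fun j => (Col j).card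
    rw [← hW]
    refine Finset.card_le_card_of_injOn (fun z i j => col j (z.2 i)) ?_ ?_
    · intro z hz
      simp only [hZ, Finset.mem_coe, Finset.mem_sigma, Fintype.mem_piFinset,
        Finset.mem_filter] at hz
      simp only [W, Finset.mem_coe, Fintype.mem_piFinset]
      exact fun i j => hcol _ (hz.2 i).1 j
    · rintro ⟨y, P⟩ hz ⟨y', P'⟩ hz' heq
      simp only [hZ, Finset.mem_coe, Finset.mem_sigma, Fintype.mem_piFinset,
        Finset.mem_filter] at hz hz'
      have hPP : P = P' := by
        refine hdet P P' (fun i => (hz.2 i).1) (fun i => (hz'.2 i).1) ?_ ?_ ?_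
        · intro i i' j hj
          exact congrFun ((hz.2 i).2.trans (hz.2 i').2.symm) ⟨j, hj⟩
        · intro i i' j hj
          exact congrFun ((hz'.2 i).2.trans (hz'.2 i').2.symm) ⟨j, hj⟩
        · intro i j hj
          exact congrFun (congrFun heq i) ⟨j, hj⟩
      subst hPP
      have : y = y' := (hz.2 0).2.symm.trans (hz'.2 0).2
      rw [this]
  have hpow : X.card ^ (k + 1) ≤ Y.card ^ k * Z.card := by
    rcases Y.eq_empty_or_nonempty with h0 | hne
    · have : X.card = 0 := by rw [hsum, h0, Finset.sum_empty]
      simp [this]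
    have h := pow_sum_div_card_le_sum_pow (s := Y)
      (f := fun y => ((X.filter fun p => c p = y).card : ℝ)) (fun _ _ => by positivity) k
    have hpos : (0 : ℝ) < (Y.card : ℝ) ^ k := by
      have := hne.card_pos
      positivity
    rw [div_le_iff₀ hpos] at h
    have h2 : ((X.card : ℝ)) ^ (k + 1) ≤ (Y.card : ℝ) ^ k * Z.card := by
      rw [hsum, hZcard]; push_cast; linarith
    exact_mod_cast h2
  calc X.card ^ (k + 1) ≤ Y.card ^ k * Z.card := hpow
    _ ≤ _ := by rw [hYcard]; exact Nat.mul_le_mul_left _ hZle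

end Counting

/-! ### Bounds from non-degeneracy -/

section Linear

variable {n d m : ℕ} {Γ : Submodule ℝ (FreqSpace n d)}

/-- `C` is a constant in the quantitative form of the statement that the maps `crucialMap Γ L A B`
are injective, for all those `A` and `B` for which they are. -/
def BoundsKernels (Γ : Submodule ℝ (FreqSpace n d)) (L : ℕ) (C : ℝ) : Prop :=
  ∀ (A : Finset (Fin n)) (B : Fin L → Finset (Fin n)),
    LinearMap.ker (crucialMap Γ L A B) = ⊥ → ∀ (v : Fin L → Γ) (ρ : ℝ), 0 ≤ ρ →
    (∀ k k', ∀ j ∈ A, ‖(v k : FreqSpace n d) j - (v k' : FreqSpace n d) j‖ ≤ ρ) →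
    (∀ k, ∀ j ∈ B k, ‖(v k : FreqSpace n d) j‖ ≤ ρ) →
    ∀ k j, ‖(v k : FreqSpace n d) j‖ ≤ C * ρ

lemma BoundsKernels.mono {L : ℕ} {C C' : ℝ} (h : BoundsKernels Γ L C) (hC : C ≤ C') :
    BoundsKernels Γ L C' := fun A B hker v ρ hρ hA hB k j =>
  (h A B hker v ρ hρ hA hB k j).trans (mul_le_mul_of_nonneg_right hC hρ)

lemma exists_boundsKernels (Γ : Submodule ℝ (FreqSpace n d)) (L : ℕ) :
    ∃ C, BoundsKernels Γ L C := by
  have key : ∀ AB : Finset (Fin n) × (Fin L → Finset (Fin n)), ∃ C : ℝ, 0 ≤ C ∧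
      (LinearMap.ker (crucialMap Γ L AB.1 AB.2) = ⊥ → ∀ v : Fin L → Γ,
        ‖v‖ ≤ C * ‖crucialMap Γ L AB.1 AB.2 v‖) := by
    rintro ⟨A, B⟩
    by_cases hker : LinearMap.ker (crucialMap Γ L A B) = ⊥
    · obtain ⟨C, -, hC⟩ := LinearMap.exists_antilipschitzWith (𝕜 := ℝ) (E := Fin L → Γ)
        (F := (Fin L → Fin L → A → Space d) × ((k : Fin L) → B k → Space d))
        (crucialMap Γ L A B) hker
      exact ⟨C, C.2, fun _ v => by simpa using hC.le_mul_dist v 0⟩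
    · exact ⟨0, le_rfl, fun h => absurd h hker⟩
  choose C hC0 hC using key
  obtain ⟨M, hM⟩ := (Set.finite_range C).bddAbove
  refine ⟨M, fun A B hker v ρ hρ hA hB k j => ?_⟩
  have h1 : ‖crucialMap Γ L A B v‖ ≤ ρ := by
    refine max_le ?_ ?_
    · refine (pi_norm_le_iff_of_nonneg hρ).2 fun k => (pi_norm_le_iff_of_nonneg hρ).2 fun k' =>
        (pi_norm_le_iff_of_nonneg hρ).2 fun j => ?_
      exact hA k k' j j.2
    · refine (pi_norm_le_iff_of_nonneg hρ).2 fun k => (pi_norm_le_iff_of_nonneg hρ).2 fun j => ?_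
      exact hB k j j.2
  calc ‖(v k : FreqSpace n d) j‖ ≤ ‖(v k : FreqSpace n d)‖ := PiLp.norm_apply_le _ j
    _ ≤ ‖v‖ := norm_le_pi_norm v k
    _ ≤ C (A, B) * ‖crucialMap Γ L A B v‖ := hC (A, B) hker v
    _ ≤ M * ‖crucialMap Γ L A B v‖ :=
        mul_le_mul_of_nonneg_right (hM ⟨_, rfl⟩) (norm_nonneg _)
    _ ≤ M * ρ := mul_le_mul_of_nonneg_left h1 ((hC0 (A, B)).trans (hM ⟨_, rfl⟩))

/-- Type I non-degeneracy is the case `L = 1`, `A = ∅` of the injectivity of `crucialMap`. -/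
lemma TypeI.ker_crucialMap (hΓ : Module.finrank ℝ Γ = m) (h : TypeI m Γ)
    {S : Finset (Fin n)} (hS : S.card = ⌈(m : ℝ) / d⌉₊) :
    LinearMap.ker (crucialMap Γ 1 ∅ fun _ => S) = ⊥ := by
  have h1 : LinearMap.ker ((proj S).domRestrict Γ) = ⊥ := by
    have h2 := LinearMap.finrank_range_add_finrank_ker ((proj S).domRestrict Γ)
    rw [LinearMap.range_domRestrict, h S hS, hΓ] at h2
    exact Submodule.finrank_eq_zero.1 (by omega)
  rw [LinearMap.ker_eq_bot']
  intro v hv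
  have h3 : (proj S).domRestrict Γ (v 0) = 0 := congrFun (congrArg Prod.snd hv) 0
  have h4 : v 0 = 0 := (LinearMap.ker_eq_bot'.1 h1) _ h3
  ext1 k
  rw [Subsingleton.elim k 0, h4]; rfl

end Linear

/-! ### Separated colourings -/

section Colouring

variable {n d m : ℕ} {Γ : Submodule ℝ (FreqSpace n d)} {α β : Type*}

/-- A finite family `X` of points `γ p ∈ Γ` with scales `s p > 0` and `n` colourings. Points with
the same `j`-colour are close in the `j`-th variable, up to `ρ` times the larger scale, but no two
points are close in all variables, up to `σ` times the larger scale. -/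
structure IsSeparatedColouring (Γ : Submodule ℝ (FreqSpace n d)) (ρ σ : ℝ) (X : Finset α)
    (γ : α → FreqSpace n d) (s : α → ℝ) (col : Fin n → α → β) : Prop where
  mem : ∀ p ∈ X, γ p ∈ Γ
  pos : ∀ p ∈ X, 0 < s p
  near : ∀ p ∈ X, ∀ q ∈ X, ∀ j, col j p = col j q → ‖γ p j - γ q j‖ ≤ ρ * max (s p) (s q)
  sep : ∀ p ∈ X, ∀ q ∈ X, (∀ j, ‖γ p j - γ q j‖ ≤ σ * max (s p) (s q)) → p = q

variable {ρ C : ℝ} {X : Finset α} {γ : α → FreqSpace n d} {s : α → ℝ} {col : Fin n → α → β}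

/-- The colours in `⌈m/d⌉` variables determine a point. -/
lemma IsSeparatedColouring.eq_of_col_eq
    (hX : IsSeparatedColouring Γ ρ (C * (2 * ρ)) X γ s col) (hρ : 0 ≤ ρ)
    (hC1 : BoundsKernels Γ 1 C) (hC : 0 ≤ C) (hΓ : Module.finrank ℝ Γ = m) (hI : TypeI m Γ)
    {S : Finset (Fin n)} (hS : S.card = ⌈(m : ℝ) / d⌉₊) {p q : α} (hp : p ∈ X) (hq : q ∈ X)
    (h : ∀ j ∈ S, col j p = col j q) : p = q := by
  refine hX.sep p hp q hq fun j => ?_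
  have hs : 0 ≤ max (s p) (s q) := (hX.pos p hp).le.trans (le_max_left _ _)
  have h1 := hC1 ∅ (fun _ => S) (hI.ker_crucialMap hΓ hS)
    (fun _ => ⟨γ p - γ q, Γ.sub_mem (hX.mem p hp) (hX.mem q hq)⟩) (ρ * max (s p) (s q))
    (by positivity) (by simp) (fun _ j hj => hX.near p hp q hq j (h j hj)) 0 j
  refine h1.trans ?_
  rw [mul_assoc]
  refine mul_le_mul_of_nonneg_left ?_ hC
  nlinarith [mul_nonneg hρ hs]

/-- The determination of tuples with common `A`-colours. At the index where the largest scale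
occurs, injectivity of `crucialMap` shows that the two tuples agree. So they have the same
`A`-colours, and at all other indices the colours in `⌈m/d⌉` variables agree. -/
lemma IsSeparatedColouring.tuple_eq
    (hX : IsSeparatedColouring Γ ρ (C * (2 * ρ)) X γ s col) (hρ : 0 ≤ ρ) {L : ℕ}
    (hC1 : BoundsKernels Γ 1 C) (hCL : BoundsKernels Γ L C) (hC : 0 ≤ C)
    (hΓ : Module.finrank ℝ Γ = m) (hI : TypeI m Γ)
    {A : Finset (Fin n)} {B : Fin L → Finset (Fin n)}
    (hAB : ∀ k, (A ∪ B k).card = ⌈(m : ℝ) / d⌉₊)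
    (hker : LinearMap.ker (crucialMap Γ L A B) = ⊥) (P P' : Fin L → α)
    (hP : ∀ i, P i ∈ X) (hP' : ∀ i, P' i ∈ X)
    (hA : ∀ i i', ∀ j ∈ A, col j (P i) = col j (P i'))
    (hA' : ∀ i i', ∀ j ∈ A, col j (P' i) = col j (P' i'))
    (hB : ∀ i, ∀ j ∈ B i, col j (P i) = col j (P' i)) : P = P' := by
  rcases Nat.eq_zero_or_pos L with rfl | hL
  · exact Subsingleton.elim _ _
  have : Nonempty (Fin L) := ⟨⟨0, hL⟩⟩
  obtain ⟨k₀, hk₀⟩ := Finite.exists_max fun k => max (s (P k)) (s (P' k))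
  set σ := max (s (P k₀)) (s (P' k₀)) with hσ
  have hσ0 : 0 ≤ σ := (hX.pos _ (hP k₀)).le.trans (le_max_left _ _)
  have hs : ∀ k, s (P k) ≤ σ := fun k => (le_max_left _ _).trans (hk₀ k)
  have hs' : ∀ k, s (P' k) ≤ σ := fun k => (le_max_right _ _).trans (hk₀ k)
  have heq : P k₀ = P' k₀ := by
    refine hX.sep _ (hP k₀) _ (hP' k₀) fun j => ?_
    have h1 := hCL A B hker
      (fun k => ⟨γ (P k) - γ (P' k), Γ.sub_mem (hX.mem _ (hP k)) (hX.mem _ (hP' k))⟩)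
      (2 * ρ * σ) (by positivity) ?_ ?_ k₀ j
    · rw [mul_assoc]; exact h1
    · intro k k' j hj
      have e1 := (hX.near _ (hP k) _ (hP k') j (hA k k' j hj)).trans
        (mul_le_mul_of_nonneg_left (max_le (hs k) (hs k')) hρ)
      have e2 := (hX.near _ (hP' k) _ (hP' k') j (hA' k k' j hj)).trans
        (mul_le_mul_of_nonneg_left (max_le (hs' k) (hs' k')) hρ)
      calc ‖(γ (P k) j - γ (P' k) j) - (γ (P k') j - γ (P' k') j)‖
          = ‖(γ (P k) j - γ (P k') j) - (γ (P' k) j - γ (P' k') j)‖ := by congr 1; abel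
        _ ≤ 2 * ρ * σ := (norm_sub_le _ _).trans (by linarith)
    · intro k j hj
      have e1 := (hX.near _ (hP k) _ (hP' k) j (hB k j hj)).trans
        (mul_le_mul_of_nonneg_left (max_le (hs k) (hs' k)) hρ)
      exact e1.trans (by nlinarith [mul_nonneg hρ hσ0])
  funext k
  refine hX.eq_of_col_eq hρ hC1 hC hΓ hI (hAB k) (hP k) (hP' k) fun j hj => ?_
  rcases Finset.mem_union.1 hj with hj | hj
  · rw [hA k k₀ j hj, heq, hA' k₀ k j hj]
  · exact hB k j hj

lemma IsSeparatedColouring.card_pow_le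
    (hX : IsSeparatedColouring Γ ρ (C * (2 * ρ)) X γ s col) (hρ : 0 ≤ ρ) {L : ℕ} (hL : 1 ≤ L)
    (hC1 : BoundsKernels Γ 1 C) (hCL : BoundsKernels Γ L C) (hC : 0 ≤ C)
    (hΓ : Module.finrank ℝ Γ = m) (hI : TypeI m Γ)
    {Col : Fin n → Finset β} (hcol : ∀ p ∈ X, ∀ j, col j p ∈ Col j)
    {A : Finset (Fin n)} {B : Fin L → Finset (Fin n)}
    (hAB : ∀ k, (A ∪ B k).card = ⌈(m : ℝ) / d⌉₊)
    (hker : LinearMap.ker (crucialMap Γ L A B) = ⊥) :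
    X.card ^ L ≤ (∏ j ∈ A, (Col j).card) ^ (L - 1) * ∏ i, ∏ j ∈ B i, (Col j).card := by
  classical
  obtain ⟨k, rfl⟩ : ∃ k, L = k + 1 := ⟨L - 1, by omega⟩
  exact card_pow_le_of_determined X col Col hcol A k B
    (hX.tuple_eq hρ hC1 hCL hC hΓ hI hAB hker)

end Colouring

/-! ### Cubes -/

section Cubes

variable {d : ℕ}

lemma norm_le_of_abs_apply_le {x : Space d} {ρ : ℝ} (hρ : 0 ≤ ρ) (h : ∀ k, |x k| ≤ ρ) :
    ‖x‖ ≤ d * ρ := by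
  have h1 : ‖x‖ ^ 2 ≤ d * ρ ^ 2 := by
    rw [EuclideanSpace.norm_sq_eq]
    calc ∑ k, ‖x k‖ ^ 2 ≤ ∑ _k : Fin d, ρ ^ 2 :=
          Finset.sum_le_sum fun k _ => pow_le_pow_left₀ (norm_nonneg _) (h k) 2
      _ = d * ρ ^ 2 := by simp
  refine abs_le_of_sq_le_sq' ?_ (by positivity) |>.2
  have h2 : (d : ℝ) ≤ (d : ℝ) ^ 2 := by exact_mod_cast Nat.le_self_pow two_ne_zero d
  nlinarith [sq_nonneg ρ]

lemma abs_apply_le_norm (x : Space d) (k : Fin d) : |x k| ≤ ‖x‖ := PiLp.norm_apply_le x k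

namespace Cube

lemma IsDyadic.side_pos {Q : Cube d} (h : Q.IsDyadic) : 0 < Q.side := by
  obtain ⟨l, z, h, -⟩ := h
  rw [h]; positivity

lemma center_mem {Q : Cube d} (h : 0 < Q.side) : Q.center ∈ Q.toSet :=
  fun k => ⟨by linarith, by linarith⟩

lemma abs_sub_center_le {Q : Cube d} {x : Space d} (hx : x ∈ Q.toSet) (k : Fin d) :
    |x k - Q.center k| ≤ Q.side / 2 := by
  have := hx k
  rw [abs_le]; constructor <;> linarith

lemma mem_toSet_of_abs_lt {Q : Cube d} {x : Space d}
    (hx : ∀ k, |x k - Q.center k| < Q.side / 2) : x ∈ Q.toSet := fun k => by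
  have := abs_lt.1 (hx k)
  constructor <;> linarith

lemma norm_sub_center_le {Q : Cube d} {x : Space d} (hx : x ∈ Q.toSet) (hQ : 0 ≤ Q.side) :
    ‖x - Q.center‖ ≤ d * (Q.side / 2) :=
  norm_le_of_abs_apply_le (by linarith) fun k => abs_sub_center_le hx k

lemma bounds_of_subset {Q Q' : Cube d} (hQ : 0 < Q.side) (h : Q.toSet ⊆ Q'.toSet) (k : Fin d) :
    Q'.center k - Q'.side / 2 ≤ Q.center k - Q.side / 2 ∧
      Q.center k + Q.side / 2 ≤ Q'.center k + Q'.side / 2 := by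
  have key : ∀ t : ℝ, -(Q.side / 2) ≤ t → t < Q.side / 2 →
      Q'.center k - Q'.side / 2 ≤ Q.center k + t ∧ Q.center k + t < Q'.center k + Q'.side / 2 := by
    intro t h1 h2
    have : Q.center + WithLp.toLp 2 (fun _ => t) ∈ Q.toSet := fun k => by
      constructor <;> simp <;> linarith
    simpa using h this k
  constructor
  · have := (key (-(Q.side / 2)) le_rfl (by linarith)).1
    linarith
  · refine le_of_forall_lt_imp_le_of_dense fun a ha => ?_
    have := (key (max (-(Q.side / 2)) (a - Q.center k)) (le_max_left _ _)
      (max_lt (by linarith) (by linarith))).2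
    have := le_max_right (-(Q.side / 2)) (a - Q.center k)
    linarith

lemma side_le_of_subset (hd : 1 ≤ d) {Q Q' : Cube d} (hQ : 0 < Q.side)
    (h : Q.toSet ⊆ Q'.toSet) : Q.side ≤ Q'.side := by
  have := bounds_of_subset hQ h ⟨0, hd⟩
  linarith [this.1, this.2]

lemma eq_of_subset_of_side_le (hd : 1 ≤ d) {Q Q' : Cube d} (hQ : 0 < Q.side)
    (h : Q.toSet ⊆ Q'.toSet) (hs : Q'.side ≤ Q.side) : Q = Q' := by
  have hs' : Q.side = Q'.side := le_antisymm (side_le_of_subset hd hQ h) hs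
  ext k
  · have := bounds_of_subset hQ h k
    linarith [this.1, this.2]
  · exact hs'

lemma IsDyadic.subset_of_mem {Q Q' : Cube d} (hQ : Q.IsDyadic) (hQ' : Q'.IsDyadic)
    {x : Space d} (hx : x ∈ Q.toSet) (hx' : x ∈ Q'.toSet) (hs : Q.side ≤ Q'.side) :
    Q.toSet ⊆ Q'.toSet := by
  obtain ⟨l, z, h1, h2⟩ := hQ
  obtain ⟨l', z', h1', h2'⟩ := hQ'
  rw [h1, h1'] at hs
  have hl : l ≤ l' := (zpow_le_zpow_iff_right₀ (by norm_num : (1 : ℝ) < 2)).1 hs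
  obtain ⟨w, rfl⟩ : ∃ w : ℕ, l' = l + w := ⟨(l' - l).toNat, by omega⟩
  have hp : (0 : ℝ) < 2 ^ l := by positivity
  have hw : (2 : ℝ) ^ (l + w : ℤ) = 2 ^ l * 2 ^ w := by
    rw [zpow_add₀ (by norm_num), zpow_natCast]
  rw [hw] at h1' h2'
  intro y hy k
  have a1 := hx k
  have a2 := hx' k
  have a3 := hy k
  rw [h1, h2 k] at a1 a3
  rw [h1', h2' k] at a2 ⊢
  have b1 : (2 : ℝ) ^ l * (2 ^ w * z' k) < 2 ^ l * (z k + 1) := by nlinarith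
  have b2 : (2 : ℝ) ^ l * z k < 2 ^ l * (2 ^ w * (z' k + 1)) := by nlinarith
  have c1 : (2 : ℤ) ^ w * z' k < z k + 1 := by exact_mod_cast lt_of_mul_lt_mul_left b1 hp.le
  have c2 : z k < (2 : ℤ) ^ w * (z' k + 1) := by exact_mod_cast lt_of_mul_lt_mul_left b2 hp.le
  have d1 : (2 : ℝ) ^ w * z' k ≤ z k := by exact_mod_cast Int.lt_add_one_iff.1 c1
  have d2 : (z k : ℝ) + 1 ≤ 2 ^ w * (z' k + 1) := by exact_mod_cast Int.add_one_le_of_lt c2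
  have e1 := mul_le_mul_of_nonneg_left d1 hp.le
  have e2 := mul_le_mul_of_nonneg_left d2 hp.le
  constructor <;> nlinarith

end Cube

lemma IsSparse.eq_of_norm_sub_le {L M : ℝ} {𝒬 : Set (Cube d)} (h : IsSparse L 𝒬) {Q Q' : Cube d}
    (hQ : Q ∈ 𝒬) (hQ' : Q' ∈ 𝒬) (hpos : 0 < Q.side) (hs : Q.side = Q'.side) (hML : M ≤ L)
    (hM : ‖Q.center - Q'.center‖ ≤ M * Q.side) : Q = Q' := by
  by_contra hne
  have h1 := h.2 Q hQ Q' hQ' hs hne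
  have h2 : setDist Q.toSet Q'.toSet ≤ dist Q.center Q'.center := by
    refine csInf_le ⟨0, ?_⟩ ⟨_, Cube.center_mem hpos, _, Cube.center_mem (hs ▸ hpos), rfl⟩
    rintro _ ⟨a, -, b, -, rfl⟩
    exact dist_nonneg
  rw [dist_eq_norm] at h2
  have := mul_le_mul_of_nonneg_right hML hpos.le
  linarith

/-- The center of the bounding box of a set squeezed between a cube and its double is well inside
the cube. -/
lemma abs_boxCenter_sub_le {S : Set (Space d)} {Q : Cube d} {C : ℝ} (hC : 0 < C)
    (hQ : 0 < Q.side) (h1 : (Q.dilate C).toSet ⊆ S) (h2 : S ⊆ (Q.dilate (2 * C)).toSet)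
    (k : Fin d) : |boxCenter S k - Q.center k| ≤ 3 / 8 * (C * Q.side) := by
  have hCQ : 0 < C * Q.side := mul_pos hC hQ
  have key : ∀ t : ℝ, |t| < C * Q.side / 2 →
      Q.center k + t ∈ (fun x : Space d => x k) '' S := fun t ht => by
    refine ⟨Q.center + WithLp.toLp 2 (fun _ => t), h1 (Cube.mem_toSet_of_abs_lt fun k => ?_),
      by simp⟩
    simpa [Cube.dilate] using ht
  have hbd : ∀ y ∈ (fun x : Space d => x k) '' S,
      Q.center k - C * Q.side ≤ y ∧ y ≤ Q.center k + C * Q.side := by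
    rintro _ ⟨x, hx, rfl⟩
    have := h2 hx k
    simp only [Cube.dilate] at this
    constructor <;> linarith [this.1, this.2]
  set V := (fun x : Space d => x k) '' S
  have hne : V.Nonempty := ⟨_, key 0 (by simpa using by linarith)⟩
  have i1 : sInf V ≤ Q.center k + -(C * Q.side / 4) :=
    csInf_le ⟨_, fun y hy => (hbd y hy).1⟩
      (key _ (by rw [abs_neg, abs_of_pos (by linarith)]; linarith))
  have i2 : Q.center k + C * Q.side / 4 ≤ sSup V :=
    le_csSup ⟨_, fun y hy => (hbd y hy).2⟩ (key _ (by rw [abs_of_pos (by linarith)]; linarith))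
  have i3 : Q.center k - C * Q.side ≤ sInf V := le_csInf hne fun y hy => (hbd y hy).1
  have i4 : sSup V ≤ Q.center k + C * Q.side := csSup_le hne fun y hy => (hbd y hy).2
  have : boxCenter S k = (sInf V + sSup V) / 2 := rfl
  rw [this, abs_le]
  constructor <;> linarith

/-- A large dilate of a set comparable to a cube contains all points that are not too far from
the cube. -/
lemma mem_dilateSet {S : Set (Space d)} {Q : Cube d} {C M W : ℝ} (hC : 0 < C)
    (hQ : 0 < Q.side) (h1 : (Q.dilate C).toSet ⊆ S) (h2 : S ⊆ (Q.dilate (2 * C)).toSet)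
    (hM : 0 ≤ M) (hW : 8 * (M + C) / C < W) {y : Space d}
    (hy : ‖y - Q.center‖ ≤ M * Q.side) : y ∈ dilateSet W S := by
  have hCQ : 0 < C * Q.side := mul_pos hC hQ
  have hW0 : 0 < W := lt_of_le_of_lt (by positivity) hW
  refine ⟨boxCenter S + W⁻¹ • (y - boxCenter S), h1 (Cube.mem_toSet_of_abs_lt fun k => ?_), ?_⟩
  · have a1 := abs_boxCenter_sub_le hC hQ h1 h2 k
    have a2 : |y k - Q.center k| ≤ M * Q.side := (abs_apply_le_norm (y - Q.center) k).trans hy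
    have a3 : |y k - boxCenter S k| ≤ (M + C) * Q.side := by
      have := abs_sub_le (y k) (Q.center k) (boxCenter S k)
      rw [abs_sub_comm (Q.center k)] at this
      nlinarith
    have a4 : W⁻¹ * |y k - boxCenter S k| < C * Q.side / 8 := by
      rw [inv_mul_lt_iff₀ hW0]
      rw [div_lt_iff₀ hC] at hW
      nlinarith
    have a5 : |(boxCenter S k - Q.center k) + W⁻¹ * (y k - boxCenter S k)| ≤
        |boxCenter S k - Q.center k| + W⁻¹ * |y k - boxCenter S k| := by
      refine (abs_add_le _ _).trans_eq ?_
      rw [abs_mul, abs_of_pos (inv_pos.2 hW0)]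
    simp only [Cube.dilate, PiLp.add_apply, PiLp.smul_apply, PiLp.sub_apply, smul_eq_mul]
    rw [add_sub_right_comm]
    linarith
  · rw [AffineMap.homothety_apply]
    simp [smul_smul, hW0.ne']

end Cubes

/-! ### Rectangles of the collection -/

section Collection

variable {n d m : ℕ} {Γ : Submodule ℝ (FreqSpace n d)} {c₀ C₁ C₂ C₃ : ℝ}
  {𝓡 : Set (VectorRectangle n d)} {G : Fin n → Cube d → Set (Space d)}

namespace VectorRectangle

lemma freqScale_pos (R : VectorRectangle n d) : 0 < R.freqScale := inv_pos.2 R.dyadic.side_pos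

lemma side_Ξ (R : VectorRectangle n d) (j : Fin n) : (R.Ξ j).side = R.freqScale :=
  eq_inv_of_mul_eq_one_right (R.side_mul j)

lemma side_Ξ_pos (R : VectorRectangle n d) (j : Fin n) : 0 < (R.Ξ j).side := by
  rw [R.side_Ξ]; exact R.freqScale_pos

lemma lesssim_refl (R : VectorRectangle n d) : R.Lesssim G R :=
  fun _ => ⟨subset_rfl, subset_rfl⟩

lemma I_subset_of_mem {P Q : VectorRectangle n d} {x : Space d} (hP : x ∈ P.I.toSet)
    (hQ : x ∈ Q.I.toSet) (hs : Q.freqScale ≤ P.freqScale) : P.I.toSet ⊆ Q.I.toSet :=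
  P.dyadic.subset_of_mem Q.dyadic hP hQ
    ((inv_le_inv₀ Q.dyadic.side_pos P.dyadic.side_pos).1 hs)

end VectorRectangle

lemma Rectangle.side_Ξ_pos (R : Rectangle d) : 0 < R.Ξ.side := by
  have := R.side_mul
  have := R.dyadic.side_pos
  by_contra! h
  nlinarith

lemma mem_freqCubes {R : VectorRectangle n d} (hR : R ∈ 𝓡) (j : Fin n) :
    R.Ξ j ∈ freqCubes 𝓡 j := ⟨R, hR, rfl⟩

/-- By the upper Whitney bound each `Ξ(R)` is close to a point of `Γ`. -/
lemma IsModelCollection.exists_near (h : IsModelCollection m Γ c₀ C₁ C₃ 𝓡) (hc : 0 < c₀)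
    (hC₁ : 0 < C₁) {R : VectorRectangle n d} (hR : R ∈ 𝓡) :
    ∃ γ ∈ Γ, ∀ j, ‖γ j - (R.Ξ j).center‖ ≤ (2 * c₀ * C₁ + d) * R.freqScale := by
  have hs := R.freqScale_pos
  have hne : (Set.image2 dist R.freqSet (Γ : Set (FreqSpace n d))).Nonempty :=
    (h.meets R hR).left.image2 ⟨0, Γ.zero_mem⟩
  have hpos : 0 < c₀ * (C₁ * R.freqScale) := by positivity
  have hlt : setDist R.freqSet (Γ : Set (FreqSpace n d)) < 2 * (c₀ * (C₁ * R.freqScale)) :=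
    lt_of_le_of_lt (h.whitney R hR).2 (by linarith)
  obtain ⟨_, ⟨ξ, hξ, γ, hγ, rfl⟩, hlt⟩ := exists_lt_of_csInf_lt hne hlt
  refine ⟨γ, hγ, fun j => ?_⟩
  have h1 : ‖γ j - ξ j‖ ≤ 2 * (c₀ * (C₁ * R.freqScale)) := by
    rw [dist_comm, dist_eq_norm] at hlt
    exact (PiLp.norm_apply_le (γ - ξ) j).trans hlt.le
  have h2 := Cube.norm_sub_center_le (hξ j) (R.side_Ξ_pos j).le
  rw [R.side_Ξ] at h2
  have h3 := norm_sub_le_norm_sub_add_norm_sub (γ j) (ξ j) (R.Ξ j).center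
  have h4 : (0 : ℝ) ≤ d * R.freqScale := by positivity
  linarith

/-- Sparsity: two members of the collection at the same scale, with close frequency cubes and
meeting physical cubes, are equal. -/
lemma IsModelCollection.eq_of_close (h : IsModelCollection m Γ c₀ C₁ C₃ 𝓡) (hd : 1 ≤ d)
    {P Q : VectorRectangle n d} (hP : P ∈ 𝓡) (hQ : Q ∈ 𝓡) {x : Space d} (hxP : x ∈ P.I.toSet)
    (hxQ : x ∈ Q.I.toSet) (hs : P.freqScale = Q.freqScale) {M : ℝ} (hM : M ≤ C₃)
    (hclose : ∀ j, ‖(P.Ξ j).center - (Q.Ξ j).center‖ ≤ M * P.freqScale) : P = Q := by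
  ext1
  · exact Cube.eq_of_subset_of_side_le hd P.dyadic.side_pos
      (VectorRectangle.I_subset_of_mem hxP hxQ hs.ge) (inv_injective hs).ge
  · funext j
    exact (h.sparse j).eq_of_norm_sub_le (mem_freqCubes hP j) (mem_freqCubes hQ j)
      (P.side_Ξ_pos j) (by rw [P.side_Ξ, Q.side_Ξ, hs]) hM (by rw [P.side_Ξ]; exact hclose j)

lemma IsModelCollection.mul_freqScale_lt (h : IsModelCollection m Γ c₀ C₁ C₃ 𝓡) (j : Fin n)
    {P Q : VectorRectangle n d} (hP : P ∈ 𝓡) (hQ : Q ∈ 𝓡) (hs : Q.freqScale < P.freqScale) :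
    C₃ * Q.freqScale < P.freqScale := by
  have := (h.sparse j).1 _ (mem_freqCubes hP j) _ (mem_freqCubes hQ j)
  rw [P.side_Ξ, Q.side_Ξ] at this
  exact this hs

lemma IsCentralization.center_mem (hG : IsCentralization C₂ C₃ 𝓡 G) (hC₂ : 0 < C₂)
    {P : VectorRectangle n d} (hP : P ∈ 𝓡) (j : Fin n) : (P.Ξ j).center ∈ G j (P.Ξ j) :=
  ((hG j).1 _ (mem_freqCubes hP j)).1 (Cube.center_mem (Q := (P.Ξ j).dilate C₂)
    (mul_pos hC₂ (P.side_Ξ_pos j)))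

lemma IsCentralization.norm_sub_center_le (hG : IsCentralization C₂ C₃ 𝓡 G) (hC₂ : 0 < C₂)
    {P : VectorRectangle n d} (hP : P ∈ 𝓡) {j : Fin n} {ξ : Space d} (hξ : ξ ∈ G j (P.Ξ j)) :
    ‖ξ - (P.Ξ j).center‖ ≤ d * C₂ * P.freqScale := by
  have h1 := Cube.norm_sub_center_le (((hG j).1 _ (mem_freqCubes hP j)).2 hξ)
    (mul_pos (by linarith) (P.side_Ξ_pos j)).le
  simp only [Cube.dilate, P.side_Ξ] at h1
  refine h1.trans_eq ?_
  ring

lemma IsCentralization.freqScale_le_of_subset (hG : IsCentralization C₂ C₃ 𝓡 G) (hC₂ : 0 < C₂)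
    (hd : 1 ≤ d) {P Q : VectorRectangle n d} (hP : P ∈ 𝓡) (hQ : Q ∈ 𝓡) {j : Fin n}
    (h : G j (P.Ξ j) ⊆ G j (Q.Ξ j)) : P.freqScale ≤ 2 * Q.freqScale := by
  have h1 := Cube.side_le_of_subset hd (mul_pos hC₂ (P.side_Ξ_pos j))
    (((hG j).1 _ (mem_freqCubes hP j)).1.trans
      (h.trans ((hG j).1 _ (mem_freqCubes hQ j)).2))
  simp only [Cube.dilate, P.side_Ξ, Q.side_Ξ] at h1
  by_contra! h2
  nlinarith

/-- Of two enlarged frequency cubes that meet, the one at the larger scale contains the other. -/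
lemma IsCentralization.subset_of_mem (hG : IsCentralization C₂ C₃ 𝓡 G) (hC₂ : 0 < C₂)
    (hd : 1 ≤ d) {P Q : VectorRectangle n d} (hP : P ∈ 𝓡) (hQ : Q ∈ 𝓡) {j : Fin n}
    (hs : 2 * Q.freqScale < P.freqScale) {ξ : Space d} (hξP : ξ ∈ G j (P.Ξ j))
    (hξQ : ξ ∈ G j (Q.Ξ j)) : G j (Q.Ξ j) ⊆ G j (P.Ξ j) := by
  rcases (hG j).2.1 _ ⟨_, mem_freqCubes hP j, rfl⟩ _ ⟨_, mem_freqCubes hQ j, rfl⟩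
    ⟨ξ, hξP, hξQ⟩ with h | h
  · exact absurd (hG.freqScale_le_of_subset hC₂ hd hP hQ h) (not_le.2 hs)
  · exact h

/-- Two `≲`-maximal rectangles over a common point whose frequency cubes are closer than `C₂`
times the larger scale are equal, since otherwise they are comparable. -/
lemma eq_of_close_of_maximal (h : IsModelCollection m Γ c₀ C₁ C₃ 𝓡)
    (hG : IsCentralization C₂ C₃ 𝓡 G) (hd : 1 ≤ d) (j₀ : Fin n) {M : ℝ} (hM : 0 ≤ M)
    (hMC₂ : 2 * M + 1 ≤ C₂) (hMC₃ : M ≤ C₃) (hC₃ : 2 ≤ C₃) {S : Set (VectorRectangle n d)}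
    (hS : S ⊆ 𝓡) {P Q : VectorRectangle n d} (hP : P ∈ maximalRects G S)
    (hQ : Q ∈ maximalRects G S) {x : Space d} (hxP : x ∈ P.I.toSet) (hxQ : x ∈ Q.I.toSet)
    (hclose : ∀ j, ‖(P.Ξ j).center - (Q.Ξ j).center‖ ≤ M * max P.freqScale Q.freqScale) :
    P = Q := by
  wlog hs : Q.freqScale ≤ P.freqScale generalizing P Q
  · refine (this hQ hP hxQ hxP (fun j => ?_) (le_of_not_ge hs)).symm
    rw [norm_sub_rev, max_comm]
    exact hclose j
  rw [max_eq_left hs] at hclose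
  rcases hs.lt_or_eq with hlt | heq
  · have hC₂ : 0 < C₂ := by linarith
    have hfar := h.mul_freqScale_lt j₀ (hS hP.1) (hS hQ.1) hlt
    have hQ0 := Q.freqScale_pos
    refine (hP.2 Q hQ.1 fun j => ⟨VectorRectangle.I_subset_of_mem hxP hxQ hs, ?_⟩).symm
    refine hG.subset_of_mem hC₂ hd (hS hP.1) (hS hQ.1) (by nlinarith) ?_
      (hG.center_mem hC₂ (hS hQ.1) j)
    refine ((hG j).1 _ (mem_freqCubes (hS hP.1) j)).1 (Cube.mem_toSet_of_abs_lt fun k => ?_)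
    have h1 := (abs_apply_le_norm _ k).trans (hclose j)
    rw [PiLp.sub_apply, abs_sub_comm] at h1
    refine lt_of_le_of_lt h1 ?_
    simp only [Cube.dilate, P.side_Ξ]
    nlinarith [P.freqScale_pos]
  · exact h.eq_of_close hd (hS hP.1) (hS hQ.1) hxP hxQ heq.symm hMC₃ hclose

/-- Two tops over a common point of selected trees with at least two elements are equal if their
frequency cubes are close up to any fixed multiple `M` of the larger scale, provided that `C₃` is
large. Otherwise let `P` be the one at the larger scale and `R` another element of its tree. The
set `C₂ ∘ Ξ(R_j)` strictly contains `C₂ ∘ Ξ(P_j)`, so that by centrality it contains `Ξ(Q_j)`.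
Hence `R ≲ Q`, but the tree with top `Q` has been selected before the one with top `P`. -/
lemma eq_of_close_of_two_le_ncard (h : IsModelCollection m Γ c₀ C₁ C₃ 𝓡)
    (hG : IsCentralization C₂ C₃ 𝓡 G) (hd : 1 ≤ d) (j₀ : Fin n) {M : ℝ} (hM : 0 ≤ M)
    (hC₂ : 0 < C₂) (hMC₃ : M ≤ C₃) (hdC₃ : d * C₂ ≤ C₃) (hC₃ : 2 ≤ C₃)
    (hW : 8 * (M + C₂) / C₂ < C₃ ^ (1 / 3 : ℝ)) {S : Set (VectorRectangle n d)} (hS : S ⊆ 𝓡)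
    {N : ℕ} {e : Fin N → VectorRectangle n d} (he : IsSelectionOrder G S e) {i i' : Fin N}
    (hi : 2 ≤ (selectedTree G S e i).ncard) (hi' : 2 ≤ (selectedTree G S e i').ncard)
    {x : Space d} (hx : x ∈ (e i).I.toSet) (hx' : x ∈ (e i').I.toSet)
    (hclose : ∀ j, ‖((e i).Ξ j).center - ((e i').Ξ j).center‖ ≤
      M * max (e i).freqScale (e i').freqScale) : i = i' := by
  wlog hs : (e i').freqScale ≤ (e i).freqScale generalizing i i'
  · refine (this hi' hi hx' hx (fun j => ?_) (le_of_not_ge hs)).symm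
    rw [norm_sub_rev, max_comm]
    exact hclose j
  rw [max_eq_left hs] at hclose
  have hmax : ∀ i, e i ∈ maximalRects G S := fun i => he.range_eq ▸ Set.mem_range_self i
  have hP := hS (hmax i).1
  have hQ := hS (hmax i').1
  rcases hs.lt_or_eq with hlt | heq
  · exfalso
    obtain ⟨R, ⟨hRS, hRP, hRleft⟩, hne⟩ := Set.exists_ne_of_one_lt_ncard (a := e i) hi
    have hR := hS hRS
    have hQ0 := (e i').freqScale_pos
    have hP0 := (e i).freqScale_pos
    have hRI : R.I.toSet ⊆ (e i).I.toSet := (hRP j₀).1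
    have hRs : (e i).freqScale ≤ R.freqScale :=
      (inv_le_inv₀ (e i).dyadic.side_pos R.dyadic.side_pos).2
        (Cube.side_le_of_subset hd R.dyadic.side_pos hRI)
    have hsR : (e i).freqScale < R.freqScale := by
      refine lt_of_le_of_ne hRs fun hsR => hne ?_
      have hc := Cube.center_mem R.dyadic.side_pos
      refine (h.eq_of_close hd hP hR (hRI hc) hc hsR hdC₃ fun j => ?_).symm
      rw [hsR]
      exact hG.norm_sub_center_le hC₂ hR ((hRP j).2 (hG.center_mem hC₂ hP j))
    have hfar := h.mul_freqScale_lt j₀ hR hP hsR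
    refine hRleft i' (lt_of_not_ge fun hii => ?_) fun j =>
      ⟨hRI.trans (VectorRectangle.I_subset_of_mem hx hx' hs), ?_⟩
    · exact absurd (he.smallest i i' hii) (not_le.2 hlt)
    · have hss : G j ((e i).Ξ j) ⊂ G j (R.Ξ j) := by
        refine ⟨(hRP j).2, fun hsub => ?_⟩
        have := hG.freqScale_le_of_subset hC₂ hd hR hP hsub
        nlinarith
      have hcen := (hG j).2.2 _ ⟨_, mem_freqCubes hP j, rfl⟩ _ ⟨_, mem_freqCubes hR j, rfl⟩ hss
      refine hG.subset_of_mem hC₂ hd hR hQ (by nlinarith) (hcen ?_) (hG.center_mem hC₂ hQ j)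
      have hcube := (hG j).1 _ (mem_freqCubes hP j)
      refine mem_dilateSet hC₂ ((e i).side_Ξ_pos j) hcube.1 hcube.2 hM hW ?_
      rw [norm_sub_rev, (e i).side_Ξ]
      exact hclose j
  · exact he.injective (h.eq_of_close hd hP hQ hx hx' heq.symm hMC₃ hclose)

end Collection

/-! ### Pointwise bounds from separated colourings -/

section Arrangements

/-- The `ν` cyclic enumerations of a set of `ν` elements, continued periodically to `ℕ`. -/
lemma exists_cyclic_enumerations {ι : Type*} {Υ : Finset ι} {ν : ℕ} (hΥ : Υ.card = ν)
    (hν : 0 < ν) :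
    ∃ g : Fin ν → ℕ → ι, (∀ t, Set.InjOn (g t) (Set.Iio ν)) ∧
      ∀ (f : ι → ℕ) (i : ℕ), ∏ t, f (g t i) = ∏ j ∈ Υ, f j := by
  have : NeZero ν := ⟨hν.ne'⟩
  let u : Fin ν ≃ Υ := (Υ.equivFinOfCardEq hΥ).symm
  refine ⟨fun t i => u (Fin.ofNat ν i + t), fun t i hi i' hi' h => ?_, fun f i => ?_⟩
  · have h1 := congrArg Fin.val (add_right_cancel (u.injective (Subtype.ext h)))
    simpa [Fin.ofNat, Nat.mod_eq_of_lt (Set.mem_Iio.1 hi),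
      Nat.mod_eq_of_lt (Set.mem_Iio.1 hi')] using h1
  · rw [← Finset.prod_coe_sort Υ f]
    exact Fintype.prod_equiv ((Equiv.addLeft (Fin.ofNat ν i)).trans u) _ _ fun _ => rfl

/-- The arithmetic of the large rank case. -/
lemma large_rank_arith {n d m : ℕ} (hd : 1 ≤ d) (h1 : 2 * m < n * d) (h2 : n * d < 2 * m + d)
    (hq : d - m % d ≤ m / d + 1) {a b : ℕ} (hab : m / d + 1 - (d - m % d) = a * d + b) :
    0 < m % d ∧ (d - m % d) + b + (2 * d - 1) * a ≤ n - 1 ∧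
      (d - m % d) * (d - 1) + d * (a * d + b) = m := by
  have hm := Nat.div_add_mod m d
  have hr := Nat.mod_lt m hd
  set l := m / d
  set r := m % d
  have e1 : (2 * d - 1) * a + a = 2 * (a * d) := by
    obtain ⟨d', rfl⟩ : ∃ d', d = d' + 1 := ⟨d - 1, by omega⟩
    rw [show 2 * (d' + 1) - 1 = 2 * d' + 1 by omega]
    ring
  have hlo : 2 * l < n := by
    by_contra! h
    nlinarith [Nat.mul_le_mul_right d h]
  have hhi : n < 2 * l + 3 := by
    by_contra! h
    nlinarith [Nat.mul_le_mul_right d h]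
  have hr0 : 0 < r ∧ (n = 2 * l + 1 → 2 * r < d) := by
    obtain h | h : n = 2 * l + 1 ∨ n = 2 * l + 2 := by omega
    · rw [h] at h1 h2
      exact ⟨by nlinarith, fun _ => by nlinarith⟩
    · rw [h] at h1 h2
      exact ⟨by nlinarith, fun _ => by omega⟩
  refine ⟨hr0.1, by omega, ?_⟩
  obtain ⟨q, hq'⟩ : ∃ q, d = r + q := ⟨d - r, by omega⟩
  have e2 : d - r = q := by omega
  have e3 : a * d + b + q = l + 1 := by omega
  have e4 : q * (d - 1) + q = q * d := by
    obtain ⟨d', hd'⟩ : ∃ d', d = d' + 1 := ⟨d - 1, by omega⟩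
    rw [hd', Nat.add_sub_cancel]
    ring
  rw [e2]
  nlinarith [congrArg (d * ·) e3]

end Arrangements

section Bounds

variable {n d m : ℕ} {Γ : Submodule ℝ (FreqSpace n d)} {α β : Type*}
  {ρ C : ℝ} {X : Finset α} {γ : α → FreqSpace n d} {s : α → ℝ} {col : Fin n → α → β}
  {Col : Fin n → Finset β}

lemma IsSeparatedColouring.card_le_small
    (hX : IsSeparatedColouring Γ ρ (C * (2 * ρ)) X γ s col) (hρ : 0 ≤ ρ)
    (hC1 : BoundsKernels Γ 1 C) (hC : 0 ≤ C) (hΓ : Module.finrank ℝ Γ = m) (hI : TypeI m Γ)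
    (hcol : ∀ p ∈ X, ∀ j, col j p ∈ Col j) {Υ : Finset (Fin n)}
    (hΥ : Υ.card = ⌈(m : ℝ) / d⌉₊) : X.card ≤ ∏ j ∈ Υ, (Col j).card := by
  simpa using hX.card_pow_le hρ le_rfl hC1 hC1 hC hΓ hI hcol (A := ∅) (B := fun _ => Υ)
    (by simpa using hΥ) (hI.ker_crucialMap hΓ hΥ)

lemma IsSeparatedColouring.sq_card_le_medium
    (hX : IsSeparatedColouring Γ ρ (C * (2 * ρ)) X γ s col) (hρ : 0 ≤ ρ)
    (hC1 : BoundsKernels Γ 1 C) (hC2 : BoundsKernels Γ 2 C) (hC : 0 ≤ C)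
    (hΓ : Module.finrank ℝ Γ = m) (hI : TypeI m Γ) (hII : TypeIIMedium Γ)
    (hcol : ∀ p ∈ X, ∀ j, col j p ∈ Col j) {n' : ℕ} (hn : n = 2 * n' + 2)
    (hceil : ⌈(m : ℝ) / d⌉₊ = n' + 1) {Υ : Finset (Fin n)} (hΥ : Υ.card = n - 1) :
    X.card ^ 2 ≤ ∏ j ∈ Υ, (Col j).card := by
  obtain ⟨A, hAΥ, hA⟩ := Finset.exists_subset_card_eq (show 1 ≤ Υ.card by omega)
  obtain ⟨B₁, hB₁Υ, hB₁⟩ := Finset.exists_subset_card_eq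
    (show n' ≤ (Υ \ A).card by rw [Finset.card_sdiff_of_subset hAΥ]; omega)
  have hcard : ((Υ \ A) \ B₁).card = n' := by
    rw [Finset.card_sdiff_of_subset hB₁Υ, Finset.card_sdiff_of_subset hAΥ]; omega
  have d1 : Disjoint A B₁ := (Finset.disjoint_sdiff (s := A) (t := Υ)).mono_right hB₁Υ
  have d2 : Disjoint A ((Υ \ A) \ B₁) :=
    (Finset.disjoint_sdiff (s := A) (t := Υ)).mono_right Finset.sdiff_subset
  have hker := hII n' hn A B₁ ((Υ \ A) \ B₁) d1 d2 Finset.disjoint_sdiff hA hB₁ hcard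
  have h := hX.card_pow_le hρ (by norm_num) hC1 hC2 hC hΓ hI hcol ?_ hker
  · refine h.trans_eq ?_
    rw [Fin.prod_univ_two, pow_one]
    simp only [Matrix.cons_val_zero, Matrix.cons_val_one]
    rw [mul_comm (∏ j ∈ B₁, _), Finset.prod_sdiff hB₁Υ, mul_comm, Finset.prod_sdiff hAΥ]
  · intro k
    fin_cases k
    · simp [Finset.card_union_of_disjoint d1, hA, hB₁, hceil, add_comm]
    · simp [Finset.card_union_of_disjoint d2, hA, hcard, hceil, add_comm,
        -Finset.union_sdiff_self_eq_union]

/-- The sum of the exponents in the bound of `|X|^d` from `card_pow_le` is `m`. Multiplying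
the bounds for all cyclic rearrangements of `Υ` distributes them evenly. -/
lemma IsSeparatedColouring.card_pow_le_large
    (hX : IsSeparatedColouring Γ ρ (C * (2 * ρ)) X γ s col) (hρ : 0 ≤ ρ) (hd : 1 ≤ d)
    (hC1 : BoundsKernels Γ 1 C) (hCd : BoundsKernels Γ d C) (hC : 0 ≤ C)
    (hΓ : Module.finrank ℝ Γ = m) (hI : TypeI m Γ) (hII : TypeIILarge m Γ)
    (hcol : ∀ p ∈ X, ∀ j, col j p ∈ Col j) (hn : 3 ≤ n) (h1 : 2 * m < n * d)
    (h2 : n * d < 2 * m + d) {Υ : Finset (Fin n)} (hΥ : Υ.card = n - 1) :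
    X.card ^ (d * (n - 1)) ≤ (∏ j ∈ Υ, (Col j).card) ^ m := by
  obtain ⟨hq, hII⟩ := hII
  obtain ⟨a, b, hab, hb⟩ : ∃ a b, m / d + 1 - (d - m % d) = a * d + b ∧ b < d :=
    ⟨_, _, (Nat.div_add_mod' _ d).symm, Nat.mod_lt _ hd⟩
  obtain ⟨hr0, hfit, hexp⟩ := large_rank_arith hd h1 h2 hq hab
  have hr := Nat.mod_lt m hd
  have hceil : ⌈(m : ℝ) / d⌉₊ = m / d + 1 := by
    have hd0 : (0 : ℝ) < d := by exact_mod_cast hd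
    have hm : (m : ℝ) = d * (m / d : ℕ) + (m % d : ℕ) := by
      exact_mod_cast (Nat.div_add_mod m d).symm
    have hr' : ((m % d : ℕ) : ℝ) < d := by exact_mod_cast hr
    have hr0' : (0 : ℝ) < (m % d : ℕ) := by exact_mod_cast hr0
    rw [Nat.ceil_eq_iff (by omega), Nat.add_sub_cancel, lt_div_iff₀ hd0, div_le_iff₀ hd0]
    push_cast
    constructor <;> nlinarith
  set q := d - m % d with hqdef
  set ν := n - 1 with hν
  obtain ⟨g, hg, hprod⟩ := exists_cyclic_enumerations hΥ (by omega : 0 < ν)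
  set f : Fin n → ℕ := fun j => (Col j).card
  -- Consecutive intervals in `[0, ν)` of the sizes of `A`, `W`, `U_1, …, U_{2d-1}`.
  let SA := Finset.Ico 0 q
  let SW := Finset.Ico q (q + b)
  let SU : Fin (2 * d - 1) → Finset ℕ := fun i =>
    Finset.Ico (q + b + i * a) (q + b + (i + 1) * a)
  let J : Fin d → Finset (Fin (2 * d - 1)) := fun k =>
    Finset.univ.filter fun i => (k : ℕ) ≤ i ∧ (i : ℕ) < k + d
  let SB : Fin d → Finset ℕ := fun k => (J k).biUnion SU ∪ SW
  have hSAν : ∀ x ∈ SA, x < ν := fun x hx => by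
    have := (Finset.mem_Ico.1 hx).2; omega
  have hSWν : ∀ x ∈ SW, x < ν := fun x hx => by
    have := (Finset.mem_Ico.1 hx).2; omega
  have hSUν : ∀ i, ∀ x ∈ SU i, x < ν := fun i x hx => by
    have h3 := (Finset.mem_Ico.1 hx).2
    have h4 : ((i : ℕ) + 1) * a ≤ (2 * d - 1) * a := Nat.mul_le_mul_right a i.2
    omega
  have hSBν : ∀ k, ∀ x ∈ SB k, x < ν := fun k x hx => by
    rcases Finset.mem_union.1 hx with hx | hx
    · obtain ⟨i, -, hi⟩ := Finset.mem_biUnion.1 hx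
      exact hSUν i x hi
    · exact hSWν x hx
  have dAW : Disjoint SA SW := Finset.disjoint_left.2 fun x hx hx' => by
    have := (Finset.mem_Ico.1 hx).2; have := (Finset.mem_Ico.1 hx').1; omega
  have dAU : ∀ i, Disjoint SA (SU i) := fun i => Finset.disjoint_left.2 fun x hx hx' => by
    have := (Finset.mem_Ico.1 hx).2; have := (Finset.mem_Ico.1 hx').1; omega
  have dWU : ∀ i, Disjoint SW (SU i) := fun i => Finset.disjoint_left.2 fun x hx hx' => by
    have := (Finset.mem_Ico.1 hx).2; have := (Finset.mem_Ico.1 hx').1; omega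
  have dUlt : ∀ i i' : Fin (2 * d - 1), i < i' → Disjoint (SU i) (SU i') := fun i i' hii =>
    Finset.disjoint_left.2 fun x hx hx' => by
      have h3 := (Finset.mem_Ico.1 hx).2
      have h4 := (Finset.mem_Ico.1 hx').1
      have h5 : ((i : ℕ) + 1) * a ≤ i' * a := Nat.mul_le_mul_right a (Fin.lt_def.1 hii)
      omega
  have dUU : ∀ i i' : Fin (2 * d - 1), i ≠ i' → Disjoint (SU i) (SU i') := fun i i' hii => by
    rcases lt_or_gt_of_ne hii with h | h
    · exact dUlt i i' h
    · exact (dUlt i' i h).symm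
  have cA : SA.card = q := by simp [SA]
  have cW : SW.card = b := by simp [SW]
  have cU : ∀ i, (SU i).card = a := fun i => by
    simp only [SU, Nat.card_Ico, add_mul, one_mul]; omega
  have cJ : ∀ k, (J k).card = d := fun k => by
    have : (J k).map Fin.valEmbedding = Finset.Ico (k : ℕ) (k + d) := by
      ext x
      simp only [J, Finset.mem_map, Finset.mem_filter, Finset.mem_univ, true_and,
        Fin.valEmbedding_apply, Finset.mem_Ico]
      constructor
      · rintro ⟨i, hi, rfl⟩; exact hi
      · intro hx; exact ⟨⟨x, by omega⟩, hx, rfl⟩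
    rw [← Finset.card_map Fin.valEmbedding, this]; simp
  have cB : ∀ k, (SB k).card = a * d + b := fun k => by
    rw [Finset.card_union_of_disjoint, Finset.card_biUnion fun i _ i' _ h => dUU i i' h,
      Finset.sum_congr rfl fun i _ => cU i, Finset.sum_const, cJ, cW, smul_eq_mul, mul_comm]
    exact (Finset.disjoint_biUnion_left _ _ _).2 fun i _ => (dWU i).symm
  have dAB : ∀ k, Disjoint SA (SB k) := fun k =>
    Finset.disjoint_union_right.2
      ⟨(Finset.disjoint_biUnion_right _ _ _).2 fun i _ => dAU i, dAW⟩
  have himg : ∀ t, ∀ S T : Finset ℕ, (∀ x ∈ S, x < ν) → (∀ x ∈ T, x < ν) → Disjoint S T →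
      Disjoint (S.image (g t)) (T.image (g t)) := fun t S T hS hT hST => by
    refine Finset.disjoint_left.2 fun x hx hx' => ?_
    obtain ⟨y, hy, rfl⟩ := Finset.mem_image.1 hx
    obtain ⟨z, hz, hzy⟩ := Finset.mem_image.1 hx'
    exact Finset.disjoint_left.1 hST hy (hg t (hT z hz) (hS y hy) hzy ▸ hz)
  have hinj : ∀ t, ∀ S : Finset ℕ, (∀ x ∈ S, x < ν) → Set.InjOn (g t) S := fun t S hS =>
    (hg t).mono fun x hx => hS x hx
  have hcardimg : ∀ t, ∀ S : Finset ℕ, (∀ x ∈ S, x < ν) → (S.image (g t)).card = S.card :=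
    fun t S hS => Finset.card_image_of_injOn (hinj t S hS)
  have hstep : ∀ t, X.card ^ d ≤ (∏ x ∈ SA, f (g t x)) ^ (d - 1) *
      ∏ k, ∏ x ∈ SB k, f (g t x) := fun t => by
    have hker := hII a b hab hb (SA.image (g t)) (SW.image (g t)) (fun i => (SU i).image (g t))
      (himg t _ _ hSAν hSWν dAW) (fun i => himg t _ _ hSAν (hSUν i) (dAU i))
      (fun i => himg t _ _ hSWν (hSUν i) (dWU i))
      (fun i i' h => himg t _ _ (hSUν i) (hSUν i') (dUU i i' h))
      ((hcardimg t _ hSAν).trans cA) ((hcardimg t _ hSWν).trans cW)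
      (fun i => (hcardimg t _ (hSUν i)).trans (cU i))
    have hB : (fun k : Fin d => (J k).biUnion (fun i => (SU i).image (g t)) ∪ SW.image (g t)) =
        fun k => (SB k).image (g t) := by
      funext k
      rw [Finset.image_union, Finset.biUnion_image]
    have hker' : LinearMap.ker (crucialMap Γ d (SA.image (g t))
        fun k => (SB k).image (g t)) = ⊥ := by
      have key : ∀ B, B = (fun k : Fin d => (J k).biUnion (fun i => (SU i).image (g t)) ∪
          SW.image (g t)) → LinearMap.ker (crucialMap Γ d (SA.image (g t)) B) = ⊥ := by
        rintro _ rfl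
        exact hker
      exact key _ hB.symm
    have h := hX.card_pow_le hρ hd hC1 hCd hC hΓ hI hcol (fun k => ?_) hker'
    · simpa only [Finset.prod_image (hinj t _ hSAν), Finset.prod_image (hinj t _ (hSBν _))]
        using h
    · rw [Finset.card_union_of_disjoint (himg t _ _ hSAν (hSBν k) (dAB k)), hcardimg t _ hSAν,
        hcardimg t _ (hSBν k), cA, cB, hceil]
      omega
  calc X.card ^ (d * ν) = ∏ _t : Fin ν, X.card ^ d := by simp [pow_mul]
    _ ≤ ∏ t, ((∏ x ∈ SA, f (g t x)) ^ (d - 1) * ∏ k, ∏ x ∈ SB k, f (g t x)) :=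
        Finset.prod_le_prod' fun t _ => hstep t
    _ = (∏ x ∈ SA, ∏ t, f (g t x)) ^ (d - 1) * ∏ k, ∏ x ∈ SB k, ∏ t, f (g t x) := by
        rw [Finset.prod_mul_distrib, Finset.prod_pow, Finset.prod_comm]
        congr 1
        rw [Finset.prod_comm]
        exact Finset.prod_congr rfl fun k _ => Finset.prod_comm
    _ = (∏ j ∈ Υ, f j) ^ m := by
        simp only [hprod, Finset.prod_const, cA, cB, Finset.card_univ, Fintype.card_fin]
        rw [← pow_mul, ← pow_mul, ← pow_add, ← hexp]
        congr 1
        ring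

lemma le_prod_rpow_of_pow_le {ι : Type*} {Υ : Finset ι} {N : ι → ℕ} {c p k : ℕ} (hp : 0 < p)
    (h : c ^ p ≤ (∏ j ∈ Υ, N j) ^ k) :
    (c : ℝ) ≤ ∏ j ∈ Υ, (N j : ℝ) ^ ((k : ℝ) / p) := by
  rw [Real.finsetProd_rpow Υ (fun j => (N j : ℝ)) (fun _ _ => by positivity)]
  have hprod : (0 : ℝ) ≤ ∏ j ∈ Υ, (N j : ℝ) := by positivity
  have h' : (c : ℝ) ^ p ≤ (∏ j ∈ Υ, (N j : ℝ)) ^ k := by exact_mod_cast h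
  rw [div_eq_mul_inv, Real.rpow_mul hprod, Real.rpow_natCast]
  calc (c : ℝ) = ((c : ℝ) ^ p) ^ (p⁻¹ : ℝ) :=
        (Real.pow_rpow_inv_natCast (by positivity) hp.ne').symm
    _ ≤ _ := Real.rpow_le_rpow (by positivity) h' (by positivity)

/-- The three pointwise bounds, with constant `1`, for a function `M` that is at each point
dominated by the number of elements of a separated colouring with `N j` colours. -/
lemma countingBounds_of_colourings (hn : 3 ≤ n) (hd : 1 ≤ d)
    (hrank : (m : ℝ) / d < (n : ℝ) / 2) (hΓ : Module.finrank ℝ Γ = m) (hρ : 0 ≤ ρ)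
    (hC1 : BoundsKernels Γ 1 C) (hC2 : BoundsKernels Γ 2 C) (hCd : BoundsKernels Γ d C)
    (hC : 0 ≤ C) {M : Space d → ℝ} {N : Fin n → Space d → ℝ}
    (h : ∀ x, ∃ (X : Finset α) (γ : α → FreqSpace n d) (s : α → ℝ) (col : Fin n → α → β)
      (Col : Fin n → Finset β), IsSeparatedColouring Γ ρ (C * (2 * ρ)) X γ s col ∧
        (∀ p ∈ X, ∀ j, col j p ∈ Col j) ∧ M x ≤ X.card ∧ ∀ j, ((Col j).card : ℝ) = N j x) :
    CountingBounds m Γ 1 M N := by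
  have hd0 : (0 : ℝ) < d := by exact_mod_cast hd
  refine ⟨fun _ hI Υ hΥ x => ?_, fun hr1 hr2 hI hII Υ hΥ x => ?_,
    fun _ hr2 hI hII Υ hΥ x => ?_⟩ <;>
  obtain ⟨X, γ, s, col, Col, hX, hcol, hM, hN⟩ := h x <;>
  simp only [one_mul, ← hN] <;>
  refine hM.trans ?_
  · exact_mod_cast hX.card_le_small hρ hC1 hC hΓ hI hcol hΥ
  · have hceil : 2 * ⌈(m : ℝ) / d⌉₊ = n := by
      have h1 : (⌈(m : ℝ) / d⌉₊ : ℝ) < (m : ℝ) / d + 1 := Nat.ceil_lt_add_one (by positivity)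
      have h2 : (2 * ⌈(m : ℝ) / d⌉₊ : ℝ) < n + 1 := by linarith
      have h3 : (n : ℝ) ≤ 2 * ⌈(m : ℝ) / d⌉₊ := by linarith
      have h4 : 2 * ⌈(m : ℝ) / d⌉₊ < n + 1 := by exact_mod_cast h2
      have h5 : n ≤ 2 * ⌈(m : ℝ) / d⌉₊ := by exact_mod_cast h3
      omega
    have h1 := hX.sq_card_le_medium hρ hC1 hC2 hC hΓ hI (hII.1 hr2) hcol
      (n' := ⌈(m : ℝ) / d⌉₊ - 1) (by omega) (by omega) hΥ
    have h2 := le_prod_rpow_of_pow_le (k := 1) two_pos (by rwa [pow_one])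
    simpa using h2
  · have h1 : 2 * m < n * d := by
      have : (2 * m : ℝ) < n * d := by
        rw [div_lt_iff₀ hd0] at hrank; linarith
      exact_mod_cast this
    have h2 : n * d < 2 * m + d := by
      have : (n * d : ℝ) < 2 * m + d := by
        rw [lt_div_iff₀ hd0] at hr2; linarith
      exact_mod_cast this
    have h3 := hX.card_pow_le_large hρ hd hC1 hCd hC hΓ hI (hII.2 hr2) hcol hn h1 h2 hΥ
    have h4 := le_prod_rpow_of_pow_le (Nat.mul_pos hd (by omega)) h3
    simpa [Nat.cast_sub (show 1 ≤ n by omega)] using h4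

end Bounds

/-! ### The separated colourings of the two counting problems -/

section Trees

variable {n d m : ℕ} {Γ : Submodule ℝ (FreqSpace n d)} {c₀ C₁ C₂ C₃ : ℝ}
  {𝓡 : Set (VectorRectangle n d)} {G : Fin n → Cube d → Set (Space d)}

/-- A separated colouring from centers `c p j` close to `γ p j` and from anchors `a j b` that are
close to the `j`-th centers of all points with `j`-colour `b`. -/
lemma IsSeparatedColouring.of_anchors {α β : Type*} {X : Finset α} {γ : α → FreqSpace n d}
    {s : α → ℝ} {col : Fin n → α → β} {c : α → Fin n → Space d} {a : Fin n → β → Space d}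
    {η τ σ : ℝ} (hη : 0 ≤ η) (hτ : 0 ≤ τ) (hmem : ∀ p ∈ X, γ p ∈ Γ) (hpos : ∀ p ∈ X, 0 < s p)
    (hc : ∀ p ∈ X, ∀ j, ‖γ p j - c p j‖ ≤ η * s p)
    (ha : ∀ p ∈ X, ∀ j, ‖a j (col j p) - c p j‖ ≤ τ * s p)
    (hsep : ∀ p ∈ X, ∀ q ∈ X,
      (∀ j, ‖c p j - c q j‖ ≤ (σ + 2 * η) * max (s p) (s q)) → p = q) :
    IsSeparatedColouring Γ (2 * (η + τ)) σ X γ s col where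
  mem := hmem
  pos := hpos
  near p hp q hq j h := by
    have h1 := hc p hp j
    have h2 := hc q hq j
    have h3 := ha p hp j
    have h4 := ha q hq j
    rw [h] at h3
    have hl := mul_le_mul_of_nonneg_left (le_max_left (s p) (s q)) (add_nonneg hη hτ)
    have hr := mul_le_mul_of_nonneg_left (le_max_right (s p) (s q)) (add_nonneg hη hτ)
    calc ‖γ p j - γ q j‖ = ‖((γ p j - c p j) - (a j (col j q) - c p j)) -
          ((γ q j - c q j) - (a j (col j q) - c q j))‖ := by congr 1; abel
      _ ≤ (‖γ p j - c p j‖ + ‖a j (col j q) - c p j‖) +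
          (‖γ q j - c q j‖ + ‖a j (col j q) - c q j‖) :=
        (norm_sub_le _ _).trans (add_le_add (norm_sub_le _ _) (norm_sub_le _ _))
      _ ≤ 2 * (η + τ) * max (s p) (s q) := by linarith
  sep p hp q hq h := hsep p hp q hq fun j => by
    have h1 := hc p hp j
    have h2 := hc q hq j
    have h3 := h j
    have hl := mul_le_mul_of_nonneg_left (le_max_left (s p) (s q)) hη
    have hr := mul_le_mul_of_nonneg_left (le_max_right (s p) (s q)) hη
    calc ‖c p j - c q j‖ = ‖(γ p j - γ q j) - ((γ p j - c p j) - (γ q j - c q j))‖ := by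
          congr 1; abel
      _ ≤ ‖γ p j - γ q j‖ + (‖γ p j - c p j‖ + ‖γ q j - c q j‖) :=
        (norm_sub_le _ _).trans (add_le_add le_rfl (norm_sub_le _ _))
      _ ≤ (σ + 2 * η) * max (s p) (s q) := by linarith

lemma vectorTop_selectedTree_subset {S : Set (VectorRectangle n d)} (j₀ : Fin n) {N : ℕ}
    {e : Fin N → VectorRectangle n d} (i : Fin N) :
    vectorTop (selectedTree G S e i) ⊆ (e i).I.toSet := by
  refine Set.biInter_subset_of_mem (t := fun J : Cube d => J.toSet) ⟨(e i).dyadic, ?_⟩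
  rintro _ ⟨R, hR, rfl⟩
  exact (hR.2.1 j₀).1

lemma subset_scalarTop {T : Set (Rectangle d)} {R : Rectangle d} (hR : R ∈ T) :
    R.I.toSet ⊆ scalarTop T :=
  Set.subset_iInter₂ fun _ hJ => hJ.2 _ ⟨R, hR, rfl⟩

lemma IsSelectionOrder.mem_maximalRects {S : Set (VectorRectangle n d)} {N : ℕ}
    {e : Fin N → VectorRectangle n d} (he : IsSelectionOrder G S e) (i : Fin N) :
    e i ∈ maximalRects G S := he.range_eq ▸ Set.mem_range_self i

lemma IsSelectionOrder.mem_selectedTree {S : Set (VectorRectangle n d)} {N : ℕ}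
    {e : Fin N → VectorRectangle n d} (he : IsSelectionOrder G S e) (i : Fin N) :
    e i ∈ selectedTree G S e i := by
  refine ⟨(he.mem_maximalRects i).1, (e i).lesssim_refl, fun i' hi' h => hi'.ne ?_⟩
  exact he.injective ((he.mem_maximalRects i).2 _ (he.mem_maximalRects i').1 h)

/-- A family of selected trees has at most as many members over `x` as it has indices whose top
rectangle lies over `x`. -/
lemma vectorCount_le_card {S : Set (VectorRectangle n d)} (j₀ : Fin n) {N : ℕ}
    {e : Fin N → VectorRectangle n d} {F : Set (Set (VectorRectangle n d))}
    (hF : F ⊆ selectedTrees G S e) {x : Space d} {X : Finset (Fin N)}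
    (hX : ∀ i, selectedTree G S e i ∈ F → x ∈ (e i).I.toSet → i ∈ X) :
    vectorCount F x ≤ X.card := by
  classical
  have h : {T ∈ F | x ∈ vectorTop T} ⊆ (X.image (selectedTree G S e) : Set _) := by
    rintro T ⟨hT, hx⟩
    obtain ⟨i, rfl⟩ := hF hT
    exact Finset.mem_image_of_mem _ (hX i hT (vectorTop_selectedTree_subset j₀ i hx))
  have h1 := (Set.ncard_le_ncard h (Finset.finite_toSet _)).trans
    ((Set.ncard_coe_finset _).trans_le Finset.card_image_le)
  exact Nat.cast_le.2 h1

lemma level_subset {F : Fin n → ℝ → Set (Set (Rectangle d))} {lam : Fin n → ℝ} :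
    level 𝓡 F lam ⊆ 𝓡 := fun _ h => h.1

lemma scalarRects_finite (h : 𝓡.Finite) (j : Fin n) : (scalarRects 𝓡 j).Finite := h.image _

/-- Each rectangle of a finite family lies below a `≤`-maximal one, for instance below one with
the largest physical cube. -/
lemma exists_maximal_ge (hd : 1 ≤ d) {P : Set (Rectangle d)} (hP : P.Finite) {R : Rectangle d}
    (hR : R ∈ P) : ∃ R' ∈ P, (∀ R'' ∈ P, R'.Le R'' → R'' = R') ∧ R.Le R' := by
  obtain ⟨R', ⟨hR', hle⟩, hmax⟩ := Set.exists_max_image {R' ∈ P | R.Le R'} (fun R' => R'.I.side)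
    (hP.subset fun _ h => h.1) ⟨R, hR, subset_rfl, subset_rfl⟩
  refine ⟨R', hR', fun R'' hR'' h => ?_, hle⟩
  have hs : R''.I.side ≤ R'.I.side := hmax R'' ⟨hR'', hle.1.trans h.1, h.2.trans hle.2⟩
  have hI : R'.I = R''.I := Cube.eq_of_subset_of_side_le hd R'.dyadic.side_pos h.1 hs
  have hΞs : R'.Ξ.side = R''.Ξ.side := by
    rw [eq_inv_of_mul_eq_one_right R'.side_mul, eq_inv_of_mul_eq_one_right R''.side_mul, hI]
  exact Rectangle.ext hI.symm (Cube.eq_of_subset_of_side_le hd R''.side_Ξ_pos h.2 hΞs.le)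

/-- For trees with at least two elements, the `j`-colour of a top rectangle is the selected
`j`-tree that contains its `j`-th component; a frequency of that tree is the anchor. -/
lemma exists_colouring_largeTrees (h : IsModelCollection m Γ c₀ C₁ C₃ 𝓡)
    (hG : IsCentralization C₂ C₃ 𝓡 G) (hd : 1 ≤ d) (j₀ : Fin n) (hc₀ : 0 < c₀) (hC₁ : 0 < C₁)
    (hC₂ : 0 < C₂) {η M σ : ℝ} (hη : η = 2 * c₀ * C₁ + d) (hMσ : M = σ + 2 * η) (hσ : 0 ≤ σ)
    (hMC₃ : M ≤ C₃) (hdC₃ : d * C₂ ≤ C₃) (hC₃ : 2 ≤ C₃)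
    (hW : 8 * (M + C₂) / C₂ < C₃ ^ (1 / 3 : ℝ)) {f : Fin n → Space d → ℂ}
    {φ : Fin n → Rectangle d → Space d → ℂ} {F : Fin n → ℝ → Set (Set (Rectangle d))}
    (hF : ∀ j, IsTreeSelection (G j) (f j) (φ j) (scalarRects 𝓡 j) (F j)) {lam : Fin n → ℝ}
    (hlam : ∀ j, IsDyadicNumber (lam j)) {N : ℕ} {e : Fin N → VectorRectangle n d}
    (he : IsSelectionOrder G (level 𝓡 F lam) e) (x : Space d) :
    ∃ (X : Finset (Fin N)) (γ : Fin N → FreqSpace n d) (s : Fin N → ℝ)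
      (col : Fin n → Fin N → Set (Rectangle d)) (Col : Fin n → Finset (Set (Rectangle d))),
      IsSeparatedColouring Γ (2 * (η + d * C₂)) σ X γ s col ∧
      (∀ p ∈ X, ∀ j, col j p ∈ Col j) ∧
      vectorCount (largeTrees (selectedTrees G (level 𝓡 F lam) e)) x ≤ X.card ∧
      ∀ j, ((Col j).card : ℝ) = scalarCount (F j (lam j)) x := by
  classical
  have hη0 : 0 ≤ η := by rw [hη]; positivity
  have hlev := fun i => (he.mem_maximalRects i).1
  choose γ hγ hγc using fun i => h.exists_near hc₀ hC₁ (level_subset (hlev i))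
  choose col hcolF hcol using fun j i => (hlev i).2 j
  have hfin : ∀ j, {T ∈ F j (lam j) | x ∈ scalarTop T}.Finite := fun j => by
    refine (scalarRects_finite h.finite j).finite_subsets.subset fun T hT R hR => ?_
    rw [← (hF j).union]
    exact Set.mem_biUnion (hlam j) ⟨T, hT.1, hR⟩
  choose a ha using fun j => fun T : Set (Rectangle d) =>
    show ∃ ξ : Space d, T ∈ F j (lam j) → ∀ R ∈ T, ξ ∈ G j R.Ξ by
      by_cases hT : T ∈ F j (lam j)
      · obtain ⟨-, I, ξ, -, hξ⟩ := (hF j).tree _ (hlam j) T hT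
        exact ⟨ξ, fun _ R hR => (hξ R hR).2⟩
      · exact ⟨0, fun h => absurd h hT⟩
  refine ⟨Finset.univ.filter fun i =>
      2 ≤ (selectedTree G (level 𝓡 F lam) e i).ncard ∧ x ∈ (e i).I.toSet,
    γ, fun i => (e i).freqScale, col, fun j => (hfin j).toFinset,
    .of_anchors (c := fun i j => ((e i).Ξ j).center) (a := a) hη0 (by positivity)
      (fun i _ => hγ i) (fun i _ => (e i).freqScale_pos) ?_ ?_ ?_, ?_, ?_, ?_⟩
  · intro i _ j
    rw [hη]; exact hγc i j
  · intro i _ j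
    exact hG.norm_sub_center_le hC₂ (level_subset (hlev i)) (ha j _ (hcolF j i) _ (hcol j i))
  · intro i hi i' hi' hclose
    rw [Finset.mem_filter] at hi hi'
    rw [← hMσ] at hclose
    exact eq_of_close_of_two_le_ncard h hG hd j₀ (by rw [hMσ]; positivity) hC₂ hMC₃ hdC₃ hC₃ hW
      level_subset he hi.2.1 hi'.2.1 hi.2.2 hi'.2.2 hclose
  · intro i hi j
    rw [Finset.mem_filter] at hi
    rw [Set.Finite.mem_toFinset]
    exact ⟨hcolF j i, subset_scalarTop (hcol j i) hi.2.2⟩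
  · exact vectorCount_le_card j₀ (fun T hT => hT.1) fun i hi hx =>
      Finset.mem_filter.2 ⟨Finset.mem_univ _, hi.2, hx⟩
  · intro j
    rw [scalarCount, Set.ncard_eq_toFinset_card _ (hfin j)]

/-- For trees with one element, the `j`-colour of a top rectangle is a `≤`-maximal rectangle
above its `j`-th component; the center of the frequency cube of the former is the anchor. -/
lemma exists_colouring_singleTrees (h : IsModelCollection m Γ c₀ C₁ C₃ 𝓡)
    (hG : IsCentralization C₂ C₃ 𝓡 G) (hd : 1 ≤ d) (j₀ : Fin n) (hc₀ : 0 < c₀) (hC₁ : 0 < C₁)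
    {η M σ : ℝ} (hη : η = 2 * c₀ * C₁ + d) (hMσ : M = σ + 2 * η) (hσ : 0 ≤ σ)
    (hMC₂ : 2 * M + 1 ≤ C₂) (hMC₃ : M ≤ C₃) (hC₃ : 2 ≤ C₃) {S : Set (VectorRectangle n d)}
    (hS : S ⊆ 𝓡) {P : Fin n → Set (Rectangle d)} (hP : ∀ j, (P j).Finite) {N : ℕ}
    {e : Fin N → VectorRectangle n d} (he : IsSelectionOrder G S e) (x : Space d) :
    ∃ (X : Finset (Fin N)) (γ : Fin N → FreqSpace n d) (s : Fin N → ℝ)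
      (col : Fin n → Fin N → Set (Rectangle d)) (Col : Fin n → Finset (Set (Rectangle d))),
      IsSeparatedColouring Γ (2 * (η + d)) σ X γ s col ∧
      (∀ p ∈ X, ∀ j, col j p ∈ Col j) ∧
      vectorCount (singleTreesAt (selectedTrees G S e) P) x ≤ X.card ∧
      ∀ j, ((Col j).card : ℝ) = scalarCount (maximalSingletons (P j)) x := by
  classical
  have hη0 : 0 ≤ η := by rw [hη]; positivity
  have hlev := fun i => hS (he.mem_maximalRects i).1
  choose γ hγ hγc using fun i => h.exists_near hc₀ hC₁ (hlev i)
  have hfin : ∀ j, {T ∈ maximalSingletons (P j) | x ∈ scalarTop T}.Finite := fun j =>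
    (((hP j).subset (fun _ h => h.1)).image _).subset fun _ hT => hT.1
  choose top htop using fun j i =>
    show ∃ R' : Rectangle d, (e i).comp j ∈ P j →
        R' ∈ P j ∧ (∀ R'' ∈ P j, R'.Le R'' → R'' = R') ∧ ((e i).comp j).Le R' by
      by_cases hi : (e i).comp j ∈ P j
      · obtain ⟨R', h1, h2⟩ := exists_maximal_ge hd (hP j) hi
        exact ⟨R', fun _ => ⟨h1, h2⟩⟩
      · exact ⟨(e i).comp j, fun h => absurd h hi⟩
  choose a ha using fun _ : Fin n => fun T : Set (Rectangle d) =>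
    show ∃ ξ : Space d, ∀ R : Rectangle d, T = {R} → ξ = R.Ξ.center by
      by_cases hT : ∃ R, T = {R}
      · obtain ⟨R, rfl⟩ := hT
        exact ⟨R.Ξ.center, fun R' hR' => by rw [Set.singleton_injective hR']⟩
      · exact ⟨0, fun R hR => absurd ⟨R, hR⟩ hT⟩
  refine ⟨Finset.univ.filter fun i => (∀ j, (e i).comp j ∈ P j) ∧ x ∈ (e i).I.toSet,
    γ, fun i => (e i).freqScale, fun j i => {top j i}, fun j => (hfin j).toFinset,
    .of_anchors (c := fun i j => ((e i).Ξ j).center) (a := a) hη0 (by positivity)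
      (fun i _ => hγ i) (fun i _ => (e i).freqScale_pos) ?_ ?_ ?_, ?_, ?_, ?_⟩
  · intro i _ j
    rw [hη]; exact hγc i j
  · intro i hi j
    rw [Finset.mem_filter] at hi
    have h1 := (htop j i (hi.2.1 j)).2.2.2 (Cube.center_mem (top j i).side_Ξ_pos)
    have h2 : ‖(top j i).Ξ.center - ((e i).Ξ j).center‖ ≤ d * (((e i).Ξ j).side / 2) :=
      Cube.norm_sub_center_le h1 ((e i).side_Ξ_pos j).le
    rw [ha j _ _ rfl]
    rw [(e i).side_Ξ] at h2
    refine h2.trans ?_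
    have := (e i).freqScale_pos
    gcongr
    linarith
  · intro i hi i' hi' hclose
    rw [Finset.mem_filter] at hi hi'
    rw [← hMσ] at hclose
    exact he.injective (eq_of_close_of_maximal h hG hd j₀ (by rw [hMσ]; positivity) hMC₂ hMC₃ hC₃
      hS (he.mem_maximalRects i) (he.mem_maximalRects i') hi.2.2 hi'.2.2 hclose)
  · intro i hi j
    rw [Finset.mem_filter] at hi
    obtain ⟨h1, h2, h3⟩ := htop j i (hi.2.1 j)
    rw [Set.Finite.mem_toFinset]
    exact ⟨⟨_, ⟨h1, h2⟩, rfl⟩, subset_scalarTop (Set.mem_singleton _) (h3.1 hi.2.2)⟩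
  · exact vectorCount_le_card j₀ (fun T hT => hT.1.1) fun i hi hx =>
      Finset.mem_filter.2 ⟨Finset.mem_univ _, hi.2 _ (he.mem_selectedTree i), hx⟩
  · intro j
    rw [scalarCount, Set.ncard_eq_toFinset_card _ (hfin j)]

end Trees

end FractionalRank

theorem proposition5p1 (n d m : ℕ) (hn : 3 ≤ n) (hd : 1 ≤ d) (hm : 1 ≤ m)
    (hrank : (m : ℝ) / d < (n : ℝ) / 2) :
    ∃ K : ℝ, 0 < K ∧
    ∀ Γ : Submodule ℝ (FreqSpace n d), Γ ≤ gammaZero n d → Module.finrank ℝ Γ = m →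
    ∀ c₀ : ℝ, 1 ≤ c₀ →
    ∃ b₁ : ℝ, ∀ C₁ : ℝ, b₁ ≤ C₁ →
    ∃ b₂ : ℝ, ∀ C₂ : ℝ, b₂ ≤ C₂ →
    ∃ b₃ : ℝ, ∀ C₃ : ℝ, b₃ ≤ C₃ →
    ∀ 𝓡 : Set (VectorRectangle n d), IsModelCollection m Γ c₀ C₁ C₃ 𝓡 →
    ∀ G : Fin n → Cube d → Set (Space d), IsCentralization C₂ C₃ 𝓡 G →
    ∀ (N₁ : ℕ) (D : ℝ) (φ : Fin n → Rectangle d → Space d → ℂ),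
      (∀ j, ∀ R ∈ scalarRects 𝓡 j, IsWavePacket N₁ D R (φ j R)) →
    ∀ (E : Fin n → Set (Space d)) (f : Fin n → Space d → ℂ),
      (∀ j, Bornology.IsBounded (E j)) →
      (∀ j, AEStronglyMeasurable (f j) volume) →
      (∀ j x, ‖f j x‖ ≤ (E j).indicator (fun _ => (1 : ℝ)) x) →
    ∀ F : Fin n → ℝ → Set (Set (Rectangle d)),
      (∀ j, IsTreeSelection (G j) (f j) (φ j) (scalarRects 𝓡 j) (F j)) →
    ∀ lam : Fin n → ℝ, (∀ j, IsDyadicNumber (lam j)) →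
    ∀ (N : ℕ) (e : Fin N → VectorRectangle n d), IsSelectionOrder G (level 𝓡 F lam) e →
      -- trees with at least two elements
      CountingBounds m Γ K
        (vectorCount (largeTrees (selectedTrees G (level 𝓡 F lam) e)))
        (fun j => scalarCount (F j (lam j))) ∧
      -- trees with exactly one element
      ∀ kap : Fin n → ℝ, (∀ j, IsDyadicNumber (kap j)) → (∀ j, kap j ≤ lam j) →
        CountingBounds m Γ K
          (vectorCount (singleTreesAt (selectedTrees G (level 𝓡 F lam) e)
            (fun j => sizeLevel (f j) (φ j) (⋃₀ F j (lam j)) (kap j))))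
          (fun j => scalarCount
            (maximalSingletons (sizeLevel (f j) (φ j) (⋃₀ F j (lam j)) (kap j)))) := by
  refine ⟨1, one_pos, fun Γ _ hΓ c₀ hc₀ => ?_⟩
  have j₀ : Fin n := ⟨0, by omega⟩
  obtain ⟨A₁, hA₁⟩ := exists_boundsKernels Γ 1
  obtain ⟨A₂, hA₂⟩ := exists_boundsKernels Γ 2
  obtain ⟨A₃, hA₃⟩ := exists_boundsKernels Γ d
  obtain ⟨C, hC, hK₁, hK₂, hK₃⟩ : ∃ C : ℝ, 0 ≤ C ∧ BoundsKernels Γ 1 C ∧ BoundsKernels Γ 2 C ∧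
      BoundsKernels Γ d C :=
    ⟨max 0 (max A₁ (max A₂ A₃)), le_max_left _ _, hA₁.mono (by simp), hA₂.mono (by simp),
      hA₃.mono (by simp)⟩
  refine ⟨1, fun C₁ hC₁ => ?_⟩
  obtain ⟨η, hη⟩ : ∃ η : ℝ, η = 2 * c₀ * C₁ + d := ⟨_, rfl⟩
  have hη0 : 0 ≤ η := by rw [hη]; positivity
  -- `ρ₁`, `M₁` concern trees with one element, `ρ₂`, `M₂` those with at least two.
  obtain ⟨ρ₁, hρ₁⟩ : ∃ ρ₁ : ℝ, ρ₁ = 2 * (η + d) := ⟨_, rfl⟩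
  have hρ₁0 : 0 ≤ ρ₁ := by rw [hρ₁]; positivity
  obtain ⟨M₁, hM₁⟩ : ∃ M₁ : ℝ, M₁ = C * (2 * ρ₁) + 2 * η := ⟨_, rfl⟩
  have hM₁0 : 0 ≤ M₁ := by rw [hM₁]; positivity
  refine ⟨2 * M₁ + 1, fun C₂ hC₂ => ?_⟩
  have hC₂0 : 0 < C₂ := by linarith
  obtain ⟨ρ₂, hρ₂⟩ : ∃ ρ₂ : ℝ, ρ₂ = 2 * (η + d * C₂) := ⟨_, rfl⟩
  have hρ₂0 : 0 ≤ ρ₂ := by rw [hρ₂]; positivity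
  obtain ⟨M₂, hM₂⟩ : ∃ M₂ : ℝ, M₂ = C * (2 * ρ₂) + 2 * η := ⟨_, rfl⟩
  have hM₂0 : 0 ≤ M₂ := by rw [hM₂]; positivity
  obtain ⟨W, hW⟩ : ∃ W : ℝ, W = 8 * (M₂ + C₂) / C₂ := ⟨_, rfl⟩
  have hW0 : 0 ≤ W := by rw [hW]; positivity
  refine ⟨(M₁ + M₂ + d * C₂ + 2) + (W + 1) ^ 3, fun C₃ hC₃ 𝓡 h𝓡 G hG N₁ D φ _ E f _ _ _ F hF
    lam hlam N e he => ?_⟩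
  have hdC₂ : 0 ≤ d * C₂ := by positivity
  have hW3 : 0 ≤ (W + 1) ^ 3 := by positivity
  -- `C₃^(1/3)` exceeds the factor `W` by which the sets `C₂ ∘ Ξ` have to be dilated.
  have hroot : W < C₃ ^ (1 / 3 : ℝ) := by
    have h1 : W + 1 ≤ C₃ ^ (1 / 3 : ℝ) := by
      calc W + 1 = ((W + 1) ^ 3) ^ (1 / 3 : ℝ) := by
            rw [one_div]
            exact (Real.pow_rpow_inv_natCast (by positivity) three_ne_zero).symm
        _ ≤ C₃ ^ (1 / 3 : ℝ) := Real.rpow_le_rpow hW3 (by linarith) (by norm_num)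
    linarith
  refine ⟨countingBounds_of_colourings (α := Fin N)
      (β := Set (Rectangle d)) hn hd hrank hΓ hρ₂0 hK₁ hK₂ hK₃ hC fun x => ?_,
    fun kap _ _ => countingBounds_of_colourings (α := Fin N)
      (β := Set (Rectangle d)) hn hd hrank hΓ hρ₁0 hK₁ hK₂ hK₃ hC fun x => ?_⟩
  · have := exists_colouring_largeTrees h𝓡 hG hd j₀ (by linarith) (by linarith) hC₂0 hη hM₂
      (by positivity) (by linarith) (by linarith) (by linarith) (hW ▸ hroot) hF hlam he x
    rwa [← hρ₂] at this
  · have hfin : ∀ j, (sizeLevel (f j) (φ j) (⋃₀ F j (lam j)) (kap j)).Finite := fun j => by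
      refine (scalarRects_finite h𝓡.finite j).subset fun R hR => ?_
      rw [← (hF j).union]
      exact Set.mem_biUnion (hlam j) hR.1
    have := exists_colouring_singleTrees h𝓡 hG hd j₀ (by linarith) (by linarith) hη hM₁
      (by positivity) hC₂ (by linarith) (by linarith) level_subset hfin he x
    rwa [← hρ₁] at this
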